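/- For positive integers $s_1,\dots,s_d$ and signs $z_1,\dots,z_d\in\{\pm1\}$ with $(s_1,z_1)\neq(1,1)$ (the admissible indices) let $$\zeta(s_1,\dots,s_d;z_1,\dots,z_d)=\lim_{M\to\infty}\sum_{M\ge n_1>\cdots>n_d>0}\frac{z_1^{n_1}\cdots z_d^{n_d}}{n_1^{s_1}\cdots n_d^{s_d}}$$ be the Euler sum, written $\zeta(s_1,\dots,s_d)$ with a bar over $s_j$ whenever $z_j=-1$. Let $\zeta_*\in\mathbb R[T]$ denote the $*$-regularized Euler sums, i.e. the unique extension of $\zeta$ to all indices with values in $\mathbb R[T]$ that is multiplicative for the stuffle product and satisfies $\zeta_*(1)=T$. Let $w\ge 4$, $u=w-2$, $v=w-1$, and let $\sum$ denote the sum over all pairs of positive integers $(a,c)$ with $a+c=w-1$. Then the following identities hold (those involving $\zeta_*$ as identities in $\mathbb R[T]$): \begin{align*} \sum\zeta_*(a,1,c)&=\zeta_*(1,1,u)+\zeta(v,1)+\zeta(2,u),\\ \sum\zeta_*(a,\bar1,\bar c)&=\zeta_*(1,\bar1,\bar u)+\zeta(\bar1,\bar u,\bar1)-\zeta(\bar1,\bar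 u,1)+\zeta(v,\bar1)+\zeta(\bar2,\bar u),\\ \sum\zeta(\bar a,\bar1,c)&=\zeta(\bar1,\bar1,\bar u)+\zeta(2,\bar u)+\zeta(\bar v,\bar1),\\ \sum\zeta(\bar a,1,\bar c)&=\zeta(\bar1,u,1)+\zeta(\bar1,1,u)-\zeta(\bar1,u,\bar1)+\zeta(\bar v,1)+\zeta(\bar2,u),\\ \sum\zeta(\bar a,1,c)&=\zeta(\bar1,\bar1,\bar u)+2\zeta(\bar v,1)+\zeta(\bar1,v)-\zeta(\bar1,\bar v)-\zeta(\bar v,\bar1)-\zeta(\bar u,2)-\zeta(w),\\ \sum\zeta_*(a,1,\bar c)&=\zeta(\bar u,\bar1,\bar1)-\zeta(\bar u,\bar1,1)+\zeta_*(1,1,\bar u)-\zeta(\bar v,\bar1)+\zeta(v,\bar1)\\ &\quad+2\zeta(\bar v,\bar1)-\zeta(\bar v,1)-\zeta(\bar u,\bar2)+\zeta(2)\zeta(\bar u)-\zeta(\bar w),\\ \sum\zeta_*(a,\bar1,c)&=2\zeta(u,\bar1,\bar1)-2\zeta(u,\bar1,1)+\zeta(\bar1,1,u)+\zeta_*(1,\bar1,u)-\zeta(\bar1,\bar1,u)+\zeta(\bar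 v,\bar1)\\ &\quad+\zeta(v,\bar1)+\zeta(\bar1,v)-\zeta(\bar v,1)-\zeta(\bar1,\bar v)-\zeta(2,u)-2\zeta(u,\bar2)-\zeta(\bar w)-\zeta(w),\\ \sum\zeta(\bar a,\bar1,\bar c)&=3\zeta(u,\bar1,1)-3\zeta(u,\bar1,\bar1)+\zeta(\bar1,\bar1,u)+2\zeta(\bar v,1)-\zeta(\bar v,\bar1)+\zeta(u,\bar2)+\zeta(2,u)-\zeta(u,2). \end{align*} -/

import Mathlib

open Finset Filter Topology Polynomial

/-- A signed exponent `(s, z)`: an exponent `s` together with a sign `z = ±1`.  An index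
`(s₁, …, s_d; z₁, …, z_d)` is the list of its signed exponents, outermost entry first. -/
abbrev SignedExp := ℕ × ℤˣ

/-- The unbarred entry `s`, with sign `+1`. -/
abbrev pl (s : ℕ) : SignedExp := (s, 1)

/-- The barred entry `s̄`, with sign `-1`. -/
abbrev bar (s : ℕ) : SignedExp := (s, -1)

/-- The truncated Euler sum
`∑_{M ≥ n₁ > ⋯ > n_d > 0} z₁ ^ n₁ ⋯ z_d ^ n_d / (n₁ ^ s₁ ⋯ n_d ^ s_d)`. -/
noncomputable def eulerTrunc : ℕ → List SignedExp → ℝ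
  | _, [] => 1
  | M, (s, z) :: l =>
      ∑ n ∈ Finset.Icc 1 M, (((z : ℤ) : ℝ) ^ n / (n : ℝ) ^ s) * eulerTrunc (n - 1) l

/-- The Euler sum `ζ(s₁, …, s_d; z₁, …, z_d)`, the limit of its truncations.  The limit exists for
every admissible index, see `tendsto_eulerTrunc`. -/
noncomputable def eulerSum (l : List SignedExp) : ℝ :=
  limUnder atTop fun M : ℕ => eulerTrunc M l

/-- The list (with multiplicities) of the indices in the stuffle (quasi-shuffle) product of two
indices. -/
def stuffle : List SignedExp → List SignedExp → List (List SignedExp)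
  | [], l => [l]
  | k, [] => [k]
  | a :: k, b :: l =>
      (stuffle k (b :: l)).map (a :: ·) ++ (stuffle (a :: k) l).map (b :: ·) ++
        (stuffle k l).map ((a.1 + b.1, a.2 * b.2) :: ·)
  termination_by k l => k.length + l.length

/-- The number of leading entries equal to the unbarred `1`. -/
def leadingOnes : List SignedExp → ℕ
  | [] => 0
  | a :: l => if a = pl 1 then leadingOnes l + 1 else 0

theorem length_or_leadingOnes_of_mem_stuffle (l : List SignedExp) :
    ∀ x ∈ stuffle [pl 1] l, x = pl 1 :: l ∨ x.length < l.length + 1 ∨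
      (x.length = l.length + 1 ∧ leadingOnes x ≤ leadingOnes l) := by
  induction l with
  | nil => intro x hx; simp [stuffle] at hx; exact Or.inl hx
  | cons b l ih =>
    intro x hx
    simp only [stuffle, List.map_cons, List.map_nil, List.mem_append, List.mem_map,
      List.mem_singleton] at hx
    rcases hx with (rfl | ⟨y, hy, rfl⟩) | rfl
    · exact Or.inl rfl
    · by_cases hb : b = pl 1
      · rcases ih y hy with rfl | h | ⟨h1, h2⟩
        · left; rw [hb]
        · right; left; simpa using h
        · right; right; simp [leadingOnes, hb, h1, h2]
      · rcases ih y hy with rfl | h | ⟨h1, h2⟩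
        · right; right; simp [leadingOnes, hb]
        · right; left; simpa using h
        · right; right; simp [leadingOnes, hb, h1]
    · right; left; simp

/-- The `∗`-regularized Euler sum `ζ_∗(s₁, …, s_d; z₁, …, z_d)`, a polynomial in `T` (here `X`):
the extension of `eulerSum` from admissible to all indices that respects the stuffle product and
has `ζ_∗(1) = T`.  If `w = (1, l)` starts with exactly `k ≥ 1` unbarred ones, then `w` occurs `k`
times in the stuffle product of `(1)` and `l`, so `T ζ_∗(l) = k ζ_∗(w) + ∑ ζ_∗(x)` over the
remaining indices `x` of that product, which determines `ζ_∗(w)`. -/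
noncomputable def regStar : List SignedExp → ℝ[X]
  | [] => 1
  | a :: l =>
    if ha : a = pl 1 then
      C (1 / (leadingOnes (a :: l) : ℝ)) *
        (X * regStar l -
          (((stuffle [pl 1] l).filter (fun x => x ≠ a :: l)).attach.map
            (fun x => regStar x.1)).sum)
    else C (eulerSum (a :: l))
  termination_by w => (w.length, leadingOnes w)
  decreasing_by
    · simp [Prod.lex_def]
    · have h := x.2
      simp only [List.mem_filter, decide_eq_true_eq] at h
      rcases length_or_leadingOnes_of_mem_stuffle l x.1 h.1 with h' | h' | ⟨h1, h2⟩
      · exact absurd (h'.trans (by rw [ha])) h.2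
      · simp only [Prod.lex_def, List.length_cons]; exact Or.inl h'
      · simp only [Prod.lex_def, List.length_cons, leadingOnes, ha, if_true]
        exact Or.inr ⟨h1, by omega⟩

/-- The pairs `(a, c)` of positive integers with `a + c = n`. -/
def posPairs (n : ℕ) : Finset (ℕ × ℕ) :=
  (Finset.HasAntidiagonal.antidiagonal n).filter fun p => 1 ≤ p.1 ∧ 1 ≤ p.2

theorem eulerTrunc_succ (M : ℕ) (s : ℕ) (z : ℤˣ) (l : List SignedExp) :
    eulerTrunc (M + 1) ((s, z) :: l) = eulerTrunc M ((s, z) :: l) +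
      (((z : ℤ) : ℝ) ^ (M + 1) / ((M : ℝ) + 1) ^ s) * eulerTrunc M l := by
  simp only [eulerTrunc]
  rw [Finset.sum_Icc_succ_top (by omega)]
  simp

theorem eulerTrunc_zero (a : SignedExp) (l : List SignedExp) : eulerTrunc 0 (a :: l) = 0 := by
  simp [eulerTrunc]

theorem abs_sign_pow_div_le (M s : ℕ) (hs : 1 ≤ s) (z : ℤˣ) :
    |((z : ℤ) : ℝ) ^ (M + 1) / ((M : ℝ) + 1) ^ s| ≤ 1 / ((M : ℝ) + 1) := by
  have hz : |((z : ℤ) : ℝ)| = 1 := by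
    rcases Int.units_eq_one_or z with rfl | rfl <;> simp
  have hM : (1 : ℝ) ≤ (M : ℝ) + 1 := by linarith [Nat.cast_nonneg (α := ℝ) M]
  rw [abs_div, abs_pow, hz, one_pow, abs_of_nonneg (by positivity)]
  have : (M : ℝ) + 1 ≤ ((M : ℝ) + 1) ^ s := le_self_pow₀ hM (by omega)
  gcongr

theorem harmonic_cast_nonneg (M : ℕ) : (0 : ℝ) ≤ (harmonic M : ℝ) := by
  rw [harmonic]; push_cast; positivity

theorem harmonic_cast_succ (M : ℕ) :
    (harmonic (M + 1) : ℝ) = (harmonic M : ℝ) + 1 / ((M : ℝ) + 1) := by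
  rw [harmonic_succ]; push_cast; simp

theorem harmonic_cast_one_le (M : ℕ) : (1 : ℝ) ≤ (harmonic (M + 1) : ℝ) := by
  induction M with
  | zero => simp [harmonic]
  | succ M ih => rw [harmonic_cast_succ]; have : (0 : ℝ) ≤ 1 / (((M + 1 : ℕ) : ℝ) + 1) := by positivity
                 linarith

theorem abs_eulerTrunc_le (l : List SignedExp) (hl : ∀ a ∈ l, 1 ≤ a.1) (M : ℕ) :
    |eulerTrunc M l| ≤ (harmonic M : ℝ) ^ l.length := by
  induction l generalizing M with
  | nil => simp [eulerTrunc]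
  | cons a l ih =>
    obtain ⟨s, z⟩ := a
    have hs : 1 ≤ s := hl (s, z) (by simp)
    have ih' := ih (fun a ha => hl a (by simp [ha]))
    induction M with
    | zero => simp [eulerTrunc_zero, harmonic]
    | succ M ihM =>
      rw [eulerTrunc_succ]
      have h1 := abs_sign_pow_div_le M s hs z
      have h0 := harmonic_cast_nonneg M
      have hd : (0 : ℝ) ≤ 1 / ((M : ℝ) + 1) := by positivity
      have hle : (harmonic M : ℝ) ^ l.length ≤ (harmonic (M + 1) : ℝ) ^ l.length := by
        apply pow_le_pow_left₀ h0; rw [harmonic_cast_succ]; linarith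
      calc _ ≤ |eulerTrunc M ((s, z) :: l)| +
            |((z : ℤ) : ℝ) ^ (M + 1) / ((M : ℝ) + 1) ^ s| * |eulerTrunc M l| := by
              rw [← abs_mul]; exact abs_add_le _ _
        _ ≤ (harmonic M : ℝ) ^ (l.length + 1) +
            1 / ((M : ℝ) + 1) * (harmonic M : ℝ) ^ l.length := by
              gcongr
              · simpa using ihM
              · exact ih' M
        _ = (harmonic M : ℝ) ^ l.length * (harmonic (M + 1) : ℝ) := by
              rw [harmonic_cast_succ]; ring
        _ ≤ (harmonic (M + 1) : ℝ) ^ l.length * (harmonic (M + 1) : ℝ) := by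
              gcongr; exact harmonic_cast_nonneg _
        _ = _ := by simp [pow_succ]

theorem harmonic_pow_isLittleO (d : ℕ) (ε : ℝ) (hε : 0 < ε) :
    (fun M : ℕ => (harmonic (M + 1) : ℝ) ^ d) =o[atTop] fun M : ℕ => ((M : ℝ) + 1) ^ ε := by
  have hlog : (fun x : ℝ => (2 * Real.log x) ^ d) =o[atTop] fun x : ℝ => x ^ ε := by
    have := (isLittleO_log_rpow_rpow_atTop (d : ℝ) hε).const_mul_left (2 ^ d)
    simpa [mul_pow] using this
  have ht : Tendsto (fun M : ℕ => (M : ℝ) + 1) atTop atTop :=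
    tendsto_atTop_add_const_right _ _ tendsto_natCast_atTop_atTop
  refine Asymptotics.IsBigO.trans_isLittleO (g := fun M : ℕ => (2 * Real.log ((M : ℝ) + 1)) ^ d)
    ?_ (hlog.comp_tendsto ht)
  refine Asymptotics.IsBigO.of_bound 1 ?_
  have h1 : ∀ᶠ M : ℕ in atTop, (1 : ℝ) ≤ Real.log ((M : ℝ) + 1) :=
    (Real.tendsto_log_atTop.comp ht).eventually_ge_atTop 1
  filter_upwards [h1] with M hM
  have h2 := harmonic_le_one_add_log (M + 1)
  push_cast at h2
  have h0 := harmonic_cast_nonneg (M + 1)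
  rw [Real.norm_of_nonneg (by positivity), Real.norm_of_nonneg (by positivity), one_mul]
  gcongr
  linarith

theorem summable_harmonic_pow_div_sq (d : ℕ) :
    Summable fun M : ℕ => (harmonic (M + 1) : ℝ) ^ d / ((M : ℝ) + 1) ^ 2 := by
  have h32 : Summable fun M : ℕ => 1 / ((M : ℝ) + 1) ^ ((3 : ℝ) / 2) := by
    have := (summable_nat_add_iff 1).2 (Real.summable_one_div_nat_rpow.2
      (show (1 : ℝ) < 3 / 2 by norm_num))
    simpa using this
  refine summable_of_isBigO_nat h32 ?_
  have h := (harmonic_pow_isLittleO d (1 / 2) (by norm_num)).isBigO.mul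
    (Asymptotics.isBigO_refl (fun M : ℕ => (((M : ℝ) + 1) ^ 2)⁻¹) atTop)
  refine h.congr_right ?_ |>.congr_left ?_
  · intro M
    have hM : (0 : ℝ) < (M : ℝ) + 1 := by positivity
    rw [← Real.rpow_natCast, ← Real.rpow_neg hM.le, ← Real.rpow_add hM,
      one_div (((M : ℝ) + 1) ^ ((3 : ℝ) / 2)), ← Real.rpow_neg hM.le]
    norm_num
  · intro M; rw [div_eq_mul_inv]

/-- Truncated Euler sums converge for every admissible index: all exponents positive and the
first entry different from the unbarred `1` (the empty index is included). -/
theorem tendsto_eulerTrunc (l : List SignedExp) (hl : ∀ a ∈ l, 1 ≤ a.1)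
    (h1 : l.head? ≠ some (pl 1)) :
    Tendsto (fun M : ℕ => eulerTrunc M l) atTop (𝓝 (eulerSum l)) := by
  suffices h : ∃ x, Tendsto (fun M : ℕ => eulerTrunc M l) atTop (𝓝 x) from
    tendsto_nhds_limUnder h
  match l with
  | [] => exact ⟨1, by simp [eulerTrunc]⟩
  | (s, z) :: l =>
  have hs : 1 ≤ s := hl (s, z) (by simp)
  have hl' : ∀ a ∈ l, 1 ≤ a.1 := fun a ha => hl a (by simp [ha])
  have hmono : ∀ M d : ℕ, (harmonic M : ℝ) ^ d ≤ (harmonic (M + 1) : ℝ) ^ d := fun M d => by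
    apply pow_le_pow_left₀ (harmonic_cast_nonneg M)
    rw [harmonic_cast_succ]
    have : (0 : ℝ) ≤ 1 / ((M : ℝ) + 1) := by positivity
    linarith
  have hb : ∀ M, |eulerTrunc M l| ≤ (harmonic (M + 1) : ℝ) ^ l.length := fun M =>
    (abs_eulerTrunc_le l hl' M).trans (hmono M _)
  have hz : |((z : ℤ) : ℝ)| = 1 := by
    rcases Int.units_eq_one_or z with rfl | rfl <;> simp
  have hsum : ∀ M, eulerTrunc M ((s, z) :: l) = ∑ n ∈ Finset.range M,
      (((z : ℤ) : ℝ) ^ (n + 1) / ((n : ℝ) + 1) ^ s) * eulerTrunc n l := by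
    intro M
    induction M with
    | zero => simp [eulerTrunc_zero]
    | succ M ih => rw [eulerTrunc_succ, ih, Finset.sum_range_succ]
  by_cases hs2 : 2 ≤ s
  · have : Summable fun n : ℕ =>
        (((z : ℤ) : ℝ) ^ (n + 1) / ((n : ℝ) + 1) ^ s) * eulerTrunc n l := by
      refine Summable.of_norm_bounded (summable_harmonic_pow_div_sq l.length) fun n => ?_
      have hn : (1 : ℝ) ≤ (n : ℝ) + 1 := by linarith [Nat.cast_nonneg (α := ℝ) n]
      rw [Real.norm_eq_abs, abs_mul, abs_div, abs_pow, hz, one_pow,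
        abs_of_nonneg (by positivity : (0 : ℝ) ≤ ((n : ℝ) + 1) ^ s), div_mul_eq_mul_div, one_mul]
      have : ((n : ℝ) + 1) ^ 2 ≤ ((n : ℝ) + 1) ^ s := pow_le_pow_right₀ hn hs2
      have := hb n
      have h0 := harmonic_cast_nonneg (n + 1)
      gcongr
    refine ⟨∑' n : ℕ, (((z : ℤ) : ℝ) ^ (n + 1) / ((n : ℝ) + 1) ^ s) * eulerTrunc n l, ?_⟩
    simpa only [hsum] using this.hasSum.tendsto_sum_nat
  · have hs1 : s = 1 := by omega
    subst hs1
    have hz1 : z = -1 := by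
      rcases Int.units_eq_one_or z with rfl | rfl
      · simp at h1
      · rfl
    subst hz1
    set f : ℕ → ℝ := fun n => eulerTrunc n l / ((n : ℝ) + 1) with hf
    have hid : ∀ M, eulerTrunc M ((1, -1) :: l) =
        (∑ n ∈ Finset.range M, (-1 : ℝ) ^ (n + 1) * (f n - f (n + 1)) - f 0
          + (-1) ^ M * f M) / 2 := by
      intro M
      induction M with
      | zero => simp [eulerTrunc_zero]
      | succ M ih =>
        rw [eulerTrunc_succ, ih, Finset.sum_range_succ]
        have : eulerTrunc M l / ((M : ℝ) + 1) = f M := rfl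
        simp only [Units.val_neg, Units.val_one, Int.cast_neg, Int.cast_one, pow_one]
        rw [div_mul_eq_mul_div, mul_div_assoc, this]
        ring
    have hdiff : ∀ n, |eulerTrunc (n + 1) l - eulerTrunc n l| ≤
        (harmonic (n + 1) : ℝ) ^ l.length / ((n : ℝ) + 1) := by
      intro n
      have h0 := harmonic_cast_nonneg (n + 1)
      match l with
      | [] => simp [eulerTrunc]; positivity
      | (s', z') :: l' =>
        rw [eulerTrunc_succ, add_sub_cancel_left, abs_mul]
        have e1 := abs_sign_pow_div_le n s' (hl' (s', z') (by simp)) z'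
        have e2 := (abs_eulerTrunc_le l' (fun a ha => hl' a (by simp [ha])) n).trans (hmono n _)
        have e3 : (harmonic (n + 1) : ℝ) ^ l'.length ≤ (harmonic (n + 1) : ℝ) ^ (l'.length + 1) :=
          pow_le_pow_right₀ (harmonic_cast_one_le n) (by omega)
        calc _ ≤ 1 / ((n : ℝ) + 1) * (harmonic (n + 1) : ℝ) ^ (l'.length + 1) := by
              gcongr; exact e2.trans e3
          _ = _ := by rw [List.length_cons]; ring
    have hsm : Summable fun n : ℕ => (-1 : ℝ) ^ (n + 1) * (f n - f (n + 1)) := by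
      refine Summable.of_norm_bounded
        ((summable_harmonic_pow_div_sq l.length).mul_left 2) fun n => ?_
      have hn : (0 : ℝ) < (n : ℝ) + 1 := by positivity
      have hn2 : (0 : ℝ) < (n : ℝ) + 2 := by positivity
      rw [Real.norm_eq_abs, abs_mul, abs_pow, abs_neg, abs_one, one_pow, one_mul]
      have e : f n - f (n + 1) = eulerTrunc n l / (((n : ℝ) + 1) * ((n : ℝ) + 2)) -
          (eulerTrunc (n + 1) l - eulerTrunc n l) / ((n : ℝ) + 2) := by
        simp only [hf]; push_cast; field_simp; ring
      rw [e]
      have h0 := harmonic_cast_nonneg (n + 1)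
      calc _ ≤ |eulerTrunc n l| / (((n : ℝ) + 1) * ((n : ℝ) + 2)) +
            |eulerTrunc (n + 1) l - eulerTrunc n l| / ((n : ℝ) + 2) := by
              refine (abs_sub _ _).trans ?_
              rw [abs_div, abs_div, abs_of_pos (mul_pos hn hn2), abs_of_pos hn2]
        _ ≤ (harmonic (n + 1) : ℝ) ^ l.length / (((n : ℝ) + 1) * ((n : ℝ) + 1)) +
            (harmonic (n + 1) : ℝ) ^ l.length / ((n : ℝ) + 1) / ((n : ℝ) + 1) := by
              have := hb n
              have := hdiff n
              have : (n : ℝ) + 1 ≤ (n : ℝ) + 2 := by linarith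
              gcongr
        _ = _ := by field_simp; ring
    have hf0 : Tendsto f atTop (𝓝 0) := by
      have h := (harmonic_pow_isLittleO l.length 1 one_pos).tendsto_div_nhds_zero
      refine squeeze_zero_norm (fun n => ?_) h
      have hn : (0 : ℝ) < (n : ℝ) + 1 := by positivity
      rw [Real.norm_eq_abs, abs_div, abs_of_pos hn, Real.rpow_one]
      have := hb n
      gcongr
    have hf1 : Tendsto (fun M : ℕ => (-1 : ℝ) ^ M * f M) atTop (𝓝 0) := by
      refine squeeze_zero_norm (fun n => ?_) (tendsto_zero_iff_norm_tendsto_zero.1 hf0)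
      simp
    refine ⟨((∑' n : ℕ, (-1 : ℝ) ^ (n + 1) * (f n - f (n + 1))) - f 0 + 0) / 2, ?_⟩
    simp only [hid]
    exact ((hsm.hasSum.tendsto_sum_nat.sub_const _).add hf1).div_const 2

/-! All eight sums are treated at once, with arbitrary signs. In the truncated sum over `M ≥ n > k >
m > 0`, summing `n^(-a) m^(-c)` over `a + c = u + 1` is a geometric sum, equal to `1 / (m^u (n - m))
- 1 / (n^u (n - m))` (`sum_posPairs_inv_pow`). This splits the sum into an inner part, weighted by
`m^(-u)`, and an outer part, weighted by `n^(-u)`.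

The outer part is a combination of truncated Euler sums for every finite `M` (`outer_part_eq`):
reflecting `m ↦ n - m` leaves a convolution of two depth-one sums, computed by partial fractions.

For the inner part, `m` is fixed, `M` tends to infinity in the sum over `k` and `n`, and dominated
convergence in `m` finishes. The limit for fixed `m` comes by induction on `m`. For outermost sign
`-1` the sum over `n` converges (`tendsto_innerBar`). For sign `1` it diverges; subtracting the
single term `a = 1` replaces `1 / (n - m)` by `1 / (n - m) - 1 / n`, which telescopes
(`tendsto_innerPl`). That term is the only one of the sum needing regularization, and it stands
unchanged on both sides of the identity, so its regularized value is never computed.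

This gives `sum_eulerSum_bar` and `sum_regStar_pl`, whose right sides contain products of Euler
sums. Depth-two and depth-three stuffle relations, with `ζ(1̄,1) + ζ(2̄) = ζ(1̄,1̄)` and `2 ζ(2̄) +
ζ(2) = 0`, turn them into the stated forms. -/

/-! ### Signs and truncated sums of depth one -/

theorem sign_pow_mul_self (z : ℤˣ) (n : ℕ) : ((z : ℤ) : ℝ) ^ n * ((z : ℤ) : ℝ) ^ n = 1 := by
  rcases Int.units_eq_one_or z with rfl | rfl
  · simp
  · simp [← mul_pow]

theorem abs_sign_pow (z : ℤˣ) (n : ℕ) : |((z : ℤ) : ℝ) ^ n| = 1 := by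
  rcases Int.units_eq_one_or z with rfl | rfl <;> simp

theorem eulerTrunc_nil (M : ℕ) : eulerTrunc M [] = 1 := by
  simp [eulerTrunc]

theorem eulerTrunc_one (M : ℕ) (z : ℤˣ) :
    eulerTrunc M [(1, z)] = ∑ n ∈ Icc 1 M, ((z : ℤ) : ℝ) ^ n / (n : ℝ) := by
  simp [eulerTrunc]

theorem sum_Ioc_eq_eulerTrunc_sub (z : ℤˣ) {m n : ℕ} (h : m ≤ n) :
    ∑ k ∈ Ioc m n, ((z : ℤ) : ℝ) ^ k / (k : ℝ) =
      eulerTrunc n [(1, z)] - eulerTrunc m [(1, z)] := by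
  induction n, h using Nat.le_induction with
  | base => simp
  | succ n hn ih =>
    rw [Finset.sum_Ioc_succ_top (by omega), ih, eulerTrunc_succ, eulerTrunc_nil]
    push_cast
    ring

/-! ### Stuffle products of small depth -/

theorem eulerTrunc_mul_depth_one (M : ℕ) (a b : SignedExp) :
    eulerTrunc M [a] * eulerTrunc M [b] =
      eulerTrunc M [a, b] + eulerTrunc M [b, a] + eulerTrunc M [(a.1 + b.1, a.2 * b.2)] := by
  obtain ⟨s, y⟩ := a
  obtain ⟨t, z⟩ := b
  induction M with
  | zero => simp [eulerTrunc_zero]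
  | succ M ih =>
    simp only [eulerTrunc_succ, eulerTrunc_nil] at ih ⊢
    push_cast
    simp only [mul_pow, pow_add]
    linear_combination ih

/-- Compare increments in `M`: when the top index belongs to `b`, what remains is the product of the
sums for `a` and `c`, which the depth-one relation expands. -/
theorem eulerTrunc_mul_depth_two (M : ℕ) (a b c : SignedExp) :
    eulerTrunc M [a] * eulerTrunc M [b, c] =
      eulerTrunc M [a, b, c] + eulerTrunc M [b, a, c] + eulerTrunc M [b, c, a] +
        eulerTrunc M [(a.1 + b.1, a.2 * b.2), c] + eulerTrunc M [b, (a.1 + c.1, a.2 * c.2)] := by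
  have h := fun M => eulerTrunc_mul_depth_one M a c
  obtain ⟨r, x⟩ := a
  obtain ⟨s, y⟩ := b
  obtain ⟨t, z⟩ := c
  induction M with
  | zero => simp [eulerTrunc_zero]
  | succ M ih =>
    have h' := h M
    rw [eulerTrunc_succ M r, eulerTrunc_succ M s y [(t, z)], eulerTrunc_succ M r x [(s, y), (t, z)],
      eulerTrunc_succ M s y [(r, x), (t, z)], eulerTrunc_succ M s y [(t, z), (r, x)],
      eulerTrunc_succ M (r + s), eulerTrunc_succ M s y [(r + t, x * z)], eulerTrunc_nil]
    push_cast
    simp only [mul_pow, pow_add]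
    linear_combination ih + ((y : ℤ) : ℝ) ^ M * ((y : ℤ) : ℝ) / ((M : ℝ) + 1) ^ s * h'

/-! ### Admissibility and stuffle relations in the limit -/

/-- An index all of whose exponents are positive and whose first entry is not the unbarred `1`. -/
def Admissible (l : List SignedExp) : Prop := (∀ a ∈ l, 1 ≤ a.1) ∧ l.head? ≠ some (pl 1)

theorem Admissible.tendsto {l : List SignedExp} (h : Admissible l) :
    Tendsto (fun M : ℕ => eulerTrunc M l) atTop (𝓝 (eulerSum l)) :=
  tendsto_eulerTrunc l h.1 h.2

theorem eulerSum_mul_depth_one {a b : SignedExp} (ha : Admissible [a]) (hb : Admissible [b])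
    (hab : Admissible [(a.1 + b.1, a.2 * b.2)]) :
    eulerSum [a] * eulerSum [b] =
      eulerSum [a, b] + eulerSum [b, a] + eulerSum [(a.1 + b.1, a.2 * b.2)] := by
  refine tendsto_nhds_unique (ha.tendsto.mul hb.tendsto) ?_
  simp only [eulerTrunc_mul_depth_one]
  simp only [Admissible, List.mem_singleton, forall_eq, List.head?_cons] at ha hb hab
  refine ((Admissible.tendsto ?_).add (Admissible.tendsto ?_)).add (Admissible.tendsto ?_) <;>
    simp_all [Admissible]

theorem eulerSum_mul_depth_two {a b c : SignedExp} (ha : Admissible [a]) (hb : Admissible [b, c])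
    (hab : Admissible [(a.1 + b.1, a.2 * b.2)]) :
    eulerSum [a] * eulerSum [b, c] =
      eulerSum [a, b, c] + eulerSum [b, a, c] + eulerSum [b, c, a] +
        eulerSum [(a.1 + b.1, a.2 * b.2), c] + eulerSum [b, (a.1 + c.1, a.2 * c.2)] := by
  refine tendsto_nhds_unique (ha.tendsto.mul hb.tendsto) ?_
  simp only [eulerTrunc_mul_depth_two]
  have h1 : 1 ≤ a.1 := ha.1 a (by simp)
  have h2 : 1 ≤ b.1 := hb.1 b (by simp)
  have h3 : 1 ≤ c.1 := hb.1 c (by simp)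
  have h4 : a ≠ pl 1 := by simpa using ha.2
  have h5 : b ≠ pl 1 := by simpa using hb.2
  have h6 : (a.1 + b.1, a.2 * b.2) ≠ pl 1 := by simpa using hab.2
  refine ((((Admissible.tendsto ?_).add (Admissible.tendsto ?_)).add (Admissible.tendsto ?_)).add
    (Admissible.tendsto ?_)).add (Admissible.tendsto ?_) <;>
    refine ⟨?_, ?_⟩ <;> simp only [List.forall_mem_cons, List.head?_cons, ne_eq, Option.some.injEq] <;>
    first | assumption | (simp; omega)

/-! ### The convolution of two depth-one sums -/

/-- Under `m ↦ n - m` the denominators run through `n - k + 1, …, n - 1`, and `z^m = z^n z^(n - m)`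
because `z = ±1`. -/
theorem sum_reflect_div (z : ℤˣ) (n k : ℕ) (hk : 1 ≤ k) (hkn : k ≤ n) :
    ∑ m ∈ Icc 1 (k - 1), ((z : ℤ) : ℝ) ^ m / ((n : ℝ) - m) =
      ((z : ℤ) : ℝ) ^ n * (eulerTrunc (n - 1) [(1, z)] - eulerTrunc (n - k) [(1, z)]) := by
  induction k, hk using Nat.le_induction with
  | base => simp
  | succ k hk ih =>
    obtain ⟨j, rfl⟩ := Nat.exists_eq_add_of_lt hkn
    have e1 : k + 1 - 1 = (k - 1) + 1 := by omega
    have e2 : k + j + 1 - k = j + 1 := by omega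
    have e3 : k + j + 1 - (k + 1) = j := by omega
    rw [e1, Finset.sum_Icc_succ_top (by omega), ih (by omega), e2, e3, eulerTrunc_succ j,
      eulerTrunc_nil, Nat.sub_add_cancel hk]
    have hz := sign_pow_mul_self z (j + 1)
    have hd : ((k + j + 1 : ℕ) : ℝ) - (k : ℝ) = j + 1 := by push_cast; ring
    have hp : ((z : ℤ) : ℝ) ^ (k + j + 1) = ((z : ℤ) : ℝ) ^ k * ((z : ℤ) : ℝ) ^ (j + 1) := by
      rw [← pow_add]; rfl
    rw [hd, hp, pow_one]
    linear_combination (-((z : ℤ) : ℝ) ^ k / ((j : ℝ) + 1)) * hz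

/-- Raising `M` by one adds `y^k z^(M+1-k) / (k (M+1-k))` for each `k`. Partial fractions, with
common factor `1 / (M+1)`, split this into two depth-one sums of sign `y * z`, which are the
increments of the two double sums. -/
theorem eulerTrunc_conv (y z : ℤˣ) (M : ℕ) :
    ∑ k ∈ Icc 1 M, ((y : ℤ) : ℝ) ^ k / (k : ℝ) * eulerTrunc (M - k) [(1, z)] =
      eulerTrunc M [(1, y), (1, y * z)] + eulerTrunc M [(1, z), (1, y * z)] := by
  induction M with
  | zero => simp [eulerTrunc_zero]
  | succ M ih =>
    rw [Finset.sum_Icc_succ_top (by omega), Nat.sub_self, eulerTrunc_zero, mul_zero, add_zero,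
      eulerTrunc_succ M, eulerTrunc_succ M]
    have h1 : ∀ k ∈ Icc 1 M, ((y : ℤ) : ℝ) ^ k / (k : ℝ) * eulerTrunc (M + 1 - k) [(1, z)] =
        ((y : ℤ) : ℝ) ^ k / (k : ℝ) * eulerTrunc (M - k) [(1, z)] +
        ((z : ℤ) : ℝ) ^ (M + 1) / ((M : ℝ) + 1) * ((((y * z : ℤˣ) : ℤ) : ℝ) ^ k / k) +
        1 / ((M : ℝ) + 1) * (((y : ℤ) : ℝ) ^ k * ((z : ℤ) : ℝ) ^ (M + 1 - k) /
          (((M + 1 - k : ℕ)) : ℝ)) := by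
      intro k hk
      rw [mem_Icc] at hk
      obtain ⟨j, rfl⟩ := Nat.exists_eq_add_of_le hk.2
      have e1 : k + j + 1 - k = j + 1 := by omega
      have e2 : k + j - k = j := by omega
      have hk0 : (k : ℝ) ≠ 0 := by have := hk.1; positivity
      have hz := sign_pow_mul_self z k
      rw [e1, e2, eulerTrunc_succ, eulerTrunc_nil]
      have hp : ((z : ℤ) : ℝ) ^ (k + j + 1) = ((z : ℤ) : ℝ) ^ k * ((z : ℤ) : ℝ) ^ (j + 1) := by
        rw [← pow_add]; rfl
      rw [hp]
      push_cast
      rw [mul_pow]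
      have hj : (j : ℝ) + 1 ≠ 0 := by positivity
      have hkj : (k : ℝ) + j + 1 ≠ 0 := by positivity
      field_simp
      linear_combination (-((j : ℝ) + 1) * ((z : ℤ) : ℝ) ^ (j + 1)) * hz
    have h2 : ∑ k ∈ Icc 1 M, ((y : ℤ) : ℝ) ^ k * ((z : ℤ) : ℝ) ^ (M + 1 - k) /
        (((M + 1 - k : ℕ)) : ℝ) =
        ((y : ℤ) : ℝ) ^ (M + 1) * eulerTrunc M [(1, y * z)] := by
      rw [eulerTrunc_one, mul_sum]
      refine Finset.sum_nbij' (fun k => M + 1 - k) (fun k => M + 1 - k) ?_ ?_ ?_ ?_ ?_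
      · intro k hk; rw [mem_Icc] at *; omega
      · intro k hk; rw [mem_Icc] at *; omega
      · intro k hk; rw [mem_Icc] at *; omega
      · intro k hk; rw [mem_Icc] at *; omega
      · intro k hk
        rw [mem_Icc] at hk
        obtain ⟨j, rfl⟩ := Nat.exists_eq_add_of_le hk.2
        have e1 : k + j + 1 - k = j + 1 := by omega
        have hy := sign_pow_mul_self y (j + 1)
        have hp : ((y : ℤ) : ℝ) ^ (k + j + 1) = ((y : ℤ) : ℝ) ^ k * ((y : ℤ) : ℝ) ^ (j + 1) := by
          rw [← pow_add]; rfl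
        rw [e1, hp]
        push_cast
        rw [mul_pow]
        linear_combination
          (-((y : ℤ) : ℝ) ^ k * ((z : ℤ) : ℝ) ^ (j + 1) / ((j : ℝ) + 1)) * hy
    rw [Finset.sum_congr rfl h1, sum_add_distrib, sum_add_distrib, ih, ← mul_sum, ← mul_sum, h2,
      ← eulerTrunc_one]
    ring

/-- The part of the depth-three sum in which the exponent `u` sits on the outermost variable. -/
theorem outer_part_eq (z₁ z₂ z₃ : ℤˣ) (u M : ℕ) :
    ∑ n ∈ Icc 1 M, ((z₁ : ℤ) : ℝ) ^ n / (n : ℝ) ^ u * ∑ k ∈ Icc 1 (n - 1),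
        ((z₂ : ℤ) : ℝ) ^ k / (k : ℝ) * ∑ m ∈ Icc 1 (k - 1), ((z₃ : ℤ) : ℝ) ^ m / ((n : ℝ) - m) =
      eulerTrunc M [(u, z₁ * z₃), (1, z₂), (1, z₃)] +
      eulerTrunc M [(u, z₁ * z₃), (1, z₃), (1, z₂)] +
      eulerTrunc M [(u, z₁ * z₃), (2, z₂ * z₃)] -
      eulerTrunc M [(u, z₁ * z₃), (1, z₂), (1, z₂ * z₃)] -
      eulerTrunc M [(u, z₁ * z₃), (1, z₃), (1, z₂ * z₃)] -
      eulerTrunc M [(u + 1, z₁ * z₃ * z₂), (1, z₂ * z₃)] -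
      eulerTrunc M [(u + 1, z₁), (1, z₂ * z₃)] := by
  have hinner : ∀ n : ℕ, ∑ k ∈ Icc 1 n,
      ((z₂ : ℤ) : ℝ) ^ k / (k : ℝ) * ∑ m ∈ Icc 1 (k - 1),
        ((z₃ : ℤ) : ℝ) ^ m / (((n + 1 : ℕ) : ℝ) - m) =
      ((z₃ : ℤ) : ℝ) ^ (n + 1) * (eulerTrunc n [(1, z₂), (1, z₃)] + eulerTrunc n [(1, z₃), (1, z₂)] +
        eulerTrunc n [(2, z₂ * z₃)] - eulerTrunc (n + 1) [(1, z₂), (1, z₂ * z₃)] -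
        eulerTrunc (n + 1) [(1, z₃), (1, z₂ * z₃)]) := by
    intro n
    have h1 : ∀ k ∈ Icc 1 n, ((z₂ : ℤ) : ℝ) ^ k / (k : ℝ) * ∑ m ∈ Icc 1 (k - 1),
        ((z₃ : ℤ) : ℝ) ^ m / (((n + 1 : ℕ) : ℝ) - m) =
        ((z₃ : ℤ) : ℝ) ^ (n + 1) * eulerTrunc n [(1, z₃)] * (((z₂ : ℤ) : ℝ) ^ k / (k : ℝ)) -
        ((z₃ : ℤ) : ℝ) ^ (n + 1) *
          (((z₂ : ℤ) : ℝ) ^ k / (k : ℝ) * eulerTrunc (n + 1 - k) [(1, z₃)]) := by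
      intro k hk
      rw [mem_Icc] at hk
      rw [sum_reflect_div z₃ (n + 1) k hk.1 (by omega), Nat.add_sub_cancel]
      ring
    -- The convolution is used at `n + 1`, one above the range of `k`: its last term vanishes, being
    -- an empty depth-one sum.
    have h2 := eulerTrunc_conv z₂ z₃ (n + 1)
    rw [Finset.sum_Icc_succ_top (by omega), Nat.sub_self, eulerTrunc_zero, mul_zero, add_zero] at h2
    have h3 := eulerTrunc_mul_depth_one n (1, z₂) (1, z₃)
    rw [Finset.sum_congr rfl h1, sum_sub_distrib, ← mul_sum, ← mul_sum, h2, ← eulerTrunc_one]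
    linear_combination ((z₃ : ℤ) : ℝ) ^ (n + 1) * h3
  induction M with
  | zero => simp [eulerTrunc_zero]
  | succ M ih =>
    rw [Finset.sum_Icc_succ_top (by omega), ih, Nat.add_sub_cancel, hinner]
    simp only [eulerTrunc_succ M u, eulerTrunc_succ M (u + 1)]
    -- The double sums truncated at `M + 1` reach the outermost variable; that coincidence term is
    -- what produces the exponent `u + 1`.
    rw [eulerTrunc_succ M 1, eulerTrunc_succ M 1]
    have hz := sign_pow_mul_self z₃ (M + 1)
    push_cast
    simp only [mul_pow]
    generalize (M : ℝ) + 1 = q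
    linear_combination (-((z₁ : ℤ) : ℝ) ^ (M + 1) * eulerTrunc M [(1, z₂ * z₃)] / q ^ (u + 1)) * hz

/-! ### Triple sums -/

/-- The sum of `a k * g n m` over `M ≥ n > k > m > 0`. -/
noncomputable def tripleSum (a : ℕ → ℝ) (g : ℕ → ℕ → ℝ) (M : ℕ) : ℝ :=
  ∑ n ∈ Icc 1 M, ∑ k ∈ Icc 1 (n - 1), a k * ∑ m ∈ Icc 1 (k - 1), g n m

theorem tripleSum_congr {a : ℕ → ℝ} {g h : ℕ → ℕ → ℝ} (M : ℕ)
    (H : ∀ n m, 1 ≤ m → m < n → g n m = h n m) : tripleSum a g M = tripleSum a h M := by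
  unfold tripleSum
  refine sum_congr rfl fun n hn => sum_congr rfl fun k hk => congrArg _ (sum_congr rfl fun m hm => ?_)
  rw [mem_Icc] at hn hk hm
  exact H n m hm.1 (by omega)

theorem tripleSum_sub (a : ℕ → ℝ) (g h : ℕ → ℕ → ℝ) (M : ℕ) :
    tripleSum a (fun n m => g n m - h n m) M = tripleSum a g M - tripleSum a h M := by
  simp only [tripleSum, sum_sub_distrib, mul_sub]

theorem tripleSum_sum {ι : Type*} (s : Finset ι) (a : ℕ → ℝ) (g : ι → ℕ → ℕ → ℝ) (M : ℕ) :
    ∑ i ∈ s, tripleSum a (g i) M = tripleSum a (fun n m => ∑ i ∈ s, g i n m) M := by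
  simp only [tripleSum]
  rw [sum_comm]
  refine sum_congr rfl fun n _ => ?_
  rw [sum_comm]
  refine sum_congr rfl fun k _ => ?_
  rw [← mul_sum, sum_comm]

theorem eulerTrunc_eq_tripleSum (M a c : ℕ) (z₁ z₂ z₃ : ℤˣ) :
    eulerTrunc M [(a, z₁), (1, z₂), (c, z₃)] =
      tripleSum (fun k => ((z₂ : ℤ) : ℝ) ^ k / k)
        (fun n m => ((z₁ : ℤ) : ℝ) ^ n * ((z₃ : ℤ) : ℝ) ^ m * (((n : ℝ)⁻¹) ^ a * ((m : ℝ)⁻¹) ^ c))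
        M := by
  simp only [eulerTrunc, tripleSum, mul_one, pow_one, mul_sum]
  refine sum_congr rfl fun n _ => sum_congr rfl fun k _ => sum_congr rfl fun m _ => ?_
  simp only [inv_pow, div_eq_mul_inv]
  ring

theorem sum_posPairs (n : ℕ) (F : ℕ → ℕ → ℝ) :
    ∑ p ∈ posPairs (n + 1), F p.1 p.2 = ∑ i ∈ range n, F (i + 1) (n - i) := by
  symm
  refine Finset.sum_bij (fun i _ => (i + 1, n - i)) ?_ ?_ ?_ ?_
  · intro i hi
    simp only [posPairs, mem_filter, HasAntidiagonal.mem_antidiagonal, mem_range] at *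
    omega
  · intro i _ j _ h
    simpa using congrArg Prod.fst h
  · rintro ⟨a, c⟩ h
    simp only [posPairs, mem_filter, HasAntidiagonal.mem_antidiagonal] at h
    refine ⟨a - 1, ?_, ?_⟩
    · rw [mem_range]; omega
    · ext <;> simp <;> omega
  · intro i _
    rfl

theorem sum_posPairs_inv_pow (u : ℕ) {n m : ℕ} (hm : 1 ≤ m) (hmn : m < n) :
    ∑ p ∈ posPairs (u + 1), ((n : ℝ)⁻¹) ^ p.1 * ((m : ℝ)⁻¹) ^ p.2 =
      1 / ((m : ℝ) ^ u * ((n : ℝ) - m)) - 1 / ((n : ℝ) ^ u * ((n : ℝ) - m)) := by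
  rw [sum_posPairs u fun a c => ((n : ℝ)⁻¹) ^ a * ((m : ℝ)⁻¹) ^ c]
  have hm0 : (m : ℝ) ≠ 0 := by positivity
  have hn0 : (n : ℝ) ≠ 0 := by have : 0 < n := by omega
                               positivity
  have hd : (n : ℝ) - m ≠ 0 := by
    have : (m : ℝ) < n := by exact_mod_cast hmn
    linarith
  have hg := (Commute.all ((n : ℝ)⁻¹) ((m : ℝ)⁻¹)).geom_sum₂_mul u
  have h1 : ∑ i ∈ range u, ((n : ℝ)⁻¹) ^ (i + 1) * ((m : ℝ)⁻¹) ^ (u - i) =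
      (n : ℝ)⁻¹ * (m : ℝ)⁻¹ * ∑ i ∈ range u, ((n : ℝ)⁻¹) ^ i * ((m : ℝ)⁻¹) ^ (u - 1 - i) := by
    rw [mul_sum]
    refine sum_congr rfl fun i hi => ?_
    rw [mem_range] at hi
    obtain ⟨j, rfl⟩ := Nat.exists_eq_add_of_lt hi
    have e1 : i + j + 1 - i = j + 1 := by omega
    have e2 : i + j + 1 - 1 - i = j := by omega
    rw [e1, e2]
    ring
  rw [h1]
  -- The prefactor supplies the difference of the two ratios, which collapses the geometric sum.
  have h2 : (n : ℝ)⁻¹ * (m : ℝ)⁻¹ = - ((n : ℝ)⁻¹ - (m : ℝ)⁻¹) / ((n : ℝ) - m) := by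
    field_simp
    ring
  rw [h2]
  have h3 : ∀ S : ℝ, - ((n : ℝ)⁻¹ - (m : ℝ)⁻¹) / ((n : ℝ) - m) * S =
    - (S * ((n : ℝ)⁻¹ - (m : ℝ)⁻¹)) / ((n : ℝ) - m) := fun S => by ring
  rw [h3, hg]
  simp only [inv_pow]
  field_simp
  ring

theorem sum_posPairs_eulerTrunc (z₁ z₂ z₃ : ℤˣ) (u M : ℕ) :
    ∑ p ∈ posPairs (u + 1), eulerTrunc M [(p.1, z₁), (1, z₂), (p.2, z₃)] =
      tripleSum (fun k => ((z₂ : ℤ) : ℝ) ^ k / k)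
        (fun n m => ((z₁ : ℤ) : ℝ) ^ n * ((z₃ : ℤ) : ℝ) ^ m * (1 / ((m : ℝ) ^ u * ((n : ℝ) - m)))) M
      - tripleSum (fun k => ((z₂ : ℤ) : ℝ) ^ k / k)
        (fun n m => ((z₁ : ℤ) : ℝ) ^ n * ((z₃ : ℤ) : ℝ) ^ m * (1 / ((n : ℝ) ^ u * ((n : ℝ) - m)))) M
      := by
  simp only [eulerTrunc_eq_tripleSum]
  rw [tripleSum_sum, ← tripleSum_sub]
  refine tripleSum_congr M fun n m hm hmn => ?_
  rw [← mul_sum, sum_posPairs_inv_pow u hm hmn]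
  ring

theorem tripleSum_outer (z₁ z₂ z₃ : ℤˣ) (u M : ℕ) :
    tripleSum (fun k => ((z₂ : ℤ) : ℝ) ^ k / k)
      (fun n m => ((z₁ : ℤ) : ℝ) ^ n * ((z₃ : ℤ) : ℝ) ^ m * (1 / ((n : ℝ) ^ u * ((n : ℝ) - m)))) M =
    ∑ n ∈ Icc 1 M, ((z₁ : ℤ) : ℝ) ^ n / (n : ℝ) ^ u * ∑ k ∈ Icc 1 (n - 1),
        ((z₂ : ℤ) : ℝ) ^ k / (k : ℝ) * ∑ m ∈ Icc 1 (k - 1), ((z₃ : ℤ) : ℝ) ^ m / ((n : ℝ) - m) := by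
  simp only [tripleSum, mul_sum]
  refine sum_congr rfl fun n _ => sum_congr rfl fun k _ => sum_congr rfl fun m _ => ?_
  rw [one_div, mul_inv]
  ring

theorem tripleSum_eq_sum_inner (a : ℕ → ℝ) (g : ℕ → ℕ → ℝ) (M : ℕ) :
    tripleSum a g M = ∑ m ∈ Icc 1 M, ∑ k ∈ Ioc m M, a k * ∑ n ∈ Ioc k M, g n m := by
  simp only [tripleSum, mul_sum]
  rw [sum_comm' (t' := Icc 1 M) (s' := fun k => Ioc k M)
    (by intro n k; simp only [mem_Icc, mem_Ioc]; omega)]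
  have h : ∀ k ∈ Icc 1 M, ∑ n ∈ Ioc k M, ∑ m ∈ Icc 1 (k - 1), a k * g n m =
      ∑ m ∈ Icc 1 (k - 1), ∑ n ∈ Ioc k M, a k * g n m := fun k _ => sum_comm
  rw [sum_congr rfl h, sum_comm' (t' := Icc 1 M) (s' := fun m => Ioc m M)
    (by intro k m; simp only [mem_Icc, mem_Ioc]; omega)]

/-! ### Interchange of limits -/

/-- Tannery's theorem for sums whose range grows with the parameter: the summands are extended by
zero beyond `M`, and the limits `E` inherit the bound `b`. -/
theorem tendsto_sum_of_dominated {F : ℕ → ℕ → ℝ} {E b : ℕ → ℝ} {x : ℝ} (hb : Summable b)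
    (hbound : ∀ m M, |F M m| ≤ b m) (hE : ∀ m, 1 ≤ m → Tendsto (F · m) atTop (𝓝 (E m)))
    (hx : Tendsto (fun M => ∑ m ∈ Icc 1 M, E m) atTop (𝓝 x)) :
    Tendsto (fun M => ∑ m ∈ Icc 1 M, F M m) atTop (𝓝 x) := by
  have hIcc : ∀ (f : ℕ → ℝ) (M : ℕ), ∑ m ∈ Icc 1 M, f m =
      ∑ m ∈ range M, f (m + 1) := fun f M => by
    rw [range_eq_Ico, Finset.sum_Ico_add' f 0 M 1]
    rfl
  have hb' : Summable fun m => b (m + 1) := (summable_nat_add_iff 1).2 hb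
  have hEb : ∀ m, ‖E (m + 1)‖ ≤ b (m + 1) := fun m =>
    le_of_tendsto (hE (m + 1) (by omega)).norm
      (Eventually.of_forall fun M => by simpa using hbound (m + 1) M)
  have hEs : Summable fun m => E (m + 1) := Summable.of_norm_bounded hb' hEb
  have hx' : ∑' m, E (m + 1) = x := by
    refine tendsto_nhds_unique hEs.hasSum.tendsto_sum_nat ?_
    simpa only [hIcc] using hx
  have h := tendsto_tsum_of_dominated_convergence
    (f := fun M m => if m ∈ range M then F M (m + 1) else 0) (g := fun m => E (m + 1))
    (𝓕 := atTop) hb' ?_ ?_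
  · rw [hx'] at h
    refine h.congr fun M => ?_
    rw [hIcc, tsum_eq_sum (s := range M) (fun m hm => by simp [hm])]
    exact sum_congr rfl fun m hm => by simp [hm]
  · intro m
    refine (hE (m + 1) (by omega)).congr' ?_
    filter_upwards [eventually_gt_atTop m] with M hM
    simp [hM]
  · refine Eventually.of_forall fun M m => ?_
    by_cases hm : m ∈ range M
    · simpa [hm] using hbound (m + 1) M
    · simp only [hm, if_false, norm_zero]
      exact (norm_nonneg _).trans (hEb m)

/-! ### Auxiliary estimates -/

theorem sum_Ioc_shift (f : ℕ → ℝ) (m M : ℕ) :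
    ∑ k ∈ Ioc m M, f k = ∑ i ∈ Icc 1 (M - m), f (m + i) := by
  refine Finset.sum_nbij' (fun k => k - m) (fun i => m + i) ?_ ?_ ?_ ?_ ?_
  · intro k hk; rw [mem_Ioc] at hk; rw [mem_Icc]; omega
  · intro k hk; rw [mem_Icc] at hk; rw [mem_Ioc]; omega
  · intro k hk; rw [mem_Ioc] at hk; omega
  · intro k hk; omega
  · intro k hk
    rw [mem_Ioc] at hk
    congr 1
    omega

/-- Leibniz's estimate: an alternating sum of decreasing nonnegative terms has the sign of its first
term and is no larger. Peeling that term off leaves a shorter sum of opposite sign. -/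
theorem nonneg_le_sum_alternating {f : ℕ → ℝ} (d k : ℕ) (h0 : ∀ n, k < n → 0 ≤ f n)
    (h1 : ∀ n, k < n → f (n + 1) ≤ f n) :
    0 ≤ (-1 : ℝ) ^ (k + 1) * ∑ n ∈ Ioc k (k + d), (-1 : ℝ) ^ n * f n ∧
      (-1 : ℝ) ^ (k + 1) * ∑ n ∈ Ioc k (k + d), (-1 : ℝ) ^ n * f n ≤ f (k + 1) := by
  induction d generalizing k with
  | zero => simpa using h0 (k + 1) (by omega)
  | succ d ih =>
    obtain ⟨ih0, ih1⟩ := ih (k + 1) (fun n hn => h0 n (by omega)) (fun n hn => h1 n (by omega))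
    have hs : k + (d + 1) = k + 1 + d := by omega
    rw [hs, ← Finset.sum_Ioc_consecutive _ (Nat.le_succ k) (by omega : k + 1 ≤ k + 1 + d),
      Nat.Ioc_succ_singleton, sum_singleton]
    have hsq : (-1 : ℝ) ^ (k + 1) * (-1 : ℝ) ^ (k + 1) = 1 := by
      rw [← mul_pow]; simp
    rw [pow_succ (-1 : ℝ) (k + 1)] at ih0 ih1
    have h2 := h1 (k + 1) (by omega)
    have e : (-1 : ℝ) ^ (k + 1) * ((-1 : ℝ) ^ (k + 1) * f (k + 1) +
        ∑ n ∈ Ioc (k + 1) (k + 1 + d), (-1 : ℝ) ^ n * f n) = f (k + 1) -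
        (-1 : ℝ) ^ (k + 1) * (-1) * ∑ n ∈ Ioc (k + 1) (k + 1 + d), (-1 : ℝ) ^ n * f n := by
      linear_combination f (k + 1) * hsq
    rw [e]
    constructor <;> linarith

theorem abs_sum_alternating_le {m k : ℕ} (M : ℕ) (hmk : m < k) :
    |∑ n ∈ Ioc k M, (-1 : ℝ) ^ n / ((n : ℝ) - m)| ≤ 1 / ((k : ℝ) - m) := by
  have hmk' : (m : ℝ) < k := by exact_mod_cast hmk
  rcases le_total M k with h | h
  · rw [Ioc_eq_empty (by omega), sum_empty, abs_zero]
    exact div_nonneg zero_le_one (by linarith)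
  obtain ⟨d, rfl⟩ := Nat.exists_eq_add_of_le h
  have key := nonneg_le_sum_alternating (f := fun n : ℕ => 1 / ((n : ℝ) - m)) d k
    (fun n hn => by
      have : (k : ℝ) < n := by exact_mod_cast hn
      exact div_nonneg zero_le_one (by linarith))
    (fun n hn => by
      have : (k : ℝ) < n := by exact_mod_cast hn
      push_cast
      exact one_div_le_one_div_of_le (by linarith) (by linarith))
  have e : ∀ n : ℕ, (-1 : ℝ) ^ n * (1 / ((n : ℝ) - m)) = (-1 : ℝ) ^ n / ((n : ℝ) - m) :=
    fun n => by ring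
  simp only [e] at key
  have habs : |(-1 : ℝ) ^ (k + 1) * ∑ n ∈ Ioc k (k + d), (-1 : ℝ) ^ n / ((n : ℝ) - m)| =
      |∑ n ∈ Ioc k (k + d), (-1 : ℝ) ^ n / ((n : ℝ) - m)| := by
    rw [abs_mul, abs_pow, abs_neg, abs_one, one_pow, one_mul]
  rw [← habs, abs_of_nonneg key.1]
  refine key.2.trans ?_
  push_cast
  exact one_div_le_one_div_of_le (by linarith) (by linarith)

theorem summable_sqrt_div_sq : Summable fun n : ℕ => √(n : ℝ) / (n : ℝ) ^ 2 := by
  have h := Real.summable_one_div_nat_rpow.2 (show (1 : ℝ) < 3 / 2 by norm_num)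
  refine h.congr fun n => ?_
  rcases Nat.eq_zero_or_pos n with rfl | hn
  · norm_num
  have hn' : (0 : ℝ) < n := by exact_mod_cast hn
  rw [Real.sqrt_eq_rpow, ← Real.rpow_natCast, ← Real.rpow_sub hn', one_div, ← Real.rpow_neg hn'.le]
  norm_num

/-- With `k = m + i`, the inequality `√m √i ≤ m + i` bounds each term by `1 / (√m i^(3/2))`, so `K =
∑ n^(-3/2)` works. The bound is uniform in `M`, as dominated convergence requires. -/
theorem exists_bound_sum_inv_mul_inv : ∃ K : ℝ, 0 ≤ K ∧ ∀ m M : ℕ, 1 ≤ m →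
    ∑ k ∈ Ioc m M, 1 / (k : ℝ) * (1 / ((k : ℝ) - m)) ≤ K / √(m : ℝ) := by
  refine ⟨∑' n : ℕ, √(n : ℝ) / (n : ℝ) ^ 2, tsum_nonneg fun n => by positivity, fun m M hm => ?_⟩
  have hm' : (0 : ℝ) < m := by exact_mod_cast hm
  have hsm : (0 : ℝ) < √(m : ℝ) := Real.sqrt_pos.2 hm'
  rw [sum_Ioc_shift (fun k => 1 / (k : ℝ) * (1 / ((k : ℝ) - m)))]
  refine le_trans ?_ (div_le_div_of_nonneg_right
    (summable_sqrt_div_sq.sum_le_tsum (Icc 1 (M - m)) fun n _ => by positivity) hsm.le)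
  rw [sum_div]
  refine sum_le_sum fun i hi => ?_
  have hi' : (0 : ℝ) < i := by exact_mod_cast (mem_Icc.1 hi).1
  have hsi : (0 : ℝ) < √(i : ℝ) := Real.sqrt_pos.2 hi'
  have h1 : √(m : ℝ) * √(i : ℝ) ≤ (m : ℝ) + i := by
    nlinarith [sq_nonneg (√(m : ℝ) - √(i : ℝ)), Real.sq_sqrt hm'.le, Real.sq_sqrt hi'.le]
  push_cast
  have e : √(i : ℝ) / (i : ℝ) ^ 2 / √(m : ℝ) = 1 / (√(m : ℝ) * √(i : ℝ)) * (1 / (i : ℝ)) := by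
    have := Real.sq_sqrt hi'.le
    field_simp
    linear_combination this
  rw [e, add_sub_cancel_left]
  gcongr

theorem tendsto_eulerTrunc_one_sub (m : ℕ) :
    Tendsto (fun N : ℕ => eulerTrunc (m + N) [pl 1] - eulerTrunc N [pl 1]) atTop (𝓝 0) := by
  induction m with
  | zero => simp
  | succ m ih =>
    have h : Tendsto (fun N : ℕ => 1 / (((m + N : ℕ) : ℝ) + 1)) atTop (𝓝 0) :=
      tendsto_one_div_add_atTop_nhds_zero_nat.comp (tendsto_add_atTop_nat m |>.congr fun N => by
        rw [add_comm])
    have := ih.add h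
    rw [add_zero] at this
    refine this.congr fun N => ?_
    have e : m + 1 + N = m + N + 1 := by omega
    rw [e, eulerTrunc_succ, eulerTrunc_nil]
    simp
    ring

theorem admissible_bar_one : Admissible [bar 1] := by simp [Admissible]

/-- One formula for both signs. For `z = -1` both sums tend to `ζ(1̄)`; for `z = 1` each diverges,
but their difference tends to zero and so does the factor `1 - z^m` vanish. -/
theorem tendsto_eulerTrunc_sub_sign_mul (z : ℤˣ) (m : ℕ) :
    Tendsto (fun N : ℕ => eulerTrunc N [(1, z)] -
      ((z : ℤ) : ℝ) ^ m * eulerTrunc (m + N) [(1, z)]) atTop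
      (𝓝 ((1 - ((z : ℤ) : ℝ) ^ m) * eulerSum [bar 1])) := by
  rcases Int.units_eq_one_or z with rfl | rfl
  · have := (tendsto_eulerTrunc_one_sub m).neg
    simpa using this
  · have h := admissible_bar_one.tendsto
    have h' := h.comp (tendsto_add_atTop_nat m)
    have := h.sub (h'.const_mul (((((-1 : ℤˣ)) : ℤ) : ℝ) ^ m))
    rw [sub_mul, one_mul]
    refine this.congr fun N => ?_
    simp [add_comm]

/-! ### The inner sums for outermost sign `-1` -/

/-- The alternating sum of the increments of a depth-one sum. -/
noncomputable def altIncrement (z : ℤˣ) (m N : ℕ) : ℝ :=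
  ∑ j ∈ Icc 1 N, (-1 : ℝ) ^ j / (j : ℝ) *
    (eulerTrunc (m + j - 1) [(1, z)] - eulerTrunc m [(1, z)])

theorem altIncrement_zero (z : ℤˣ) (N : ℕ) :
    altIncrement z 0 N = eulerTrunc N [bar 1, (1, z)] := by
  rw [altIncrement]
  simp [eulerTrunc]

theorem altIncrement_succ (z : ℤˣ) (m N : ℕ) :
    altIncrement z (m + 1) N = altIncrement z m N +
      ∑ j ∈ Icc 1 N, (-1 : ℝ) ^ j / (j : ℝ) * (((z : ℤ) : ℝ) ^ (m + j) / ((m : ℝ) + j)) -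
      ((z : ℤ) : ℝ) ^ (m + 1) / ((m : ℝ) + 1) * eulerTrunc N [bar 1] := by
  rw [altIncrement, altIncrement, eulerTrunc_one N, mul_sum, ← sum_add_distrib, ← sum_sub_distrib]
  refine sum_congr rfl fun j hj => ?_
  obtain ⟨i, rfl⟩ := Nat.exists_eq_add_of_le' (mem_Icc.1 hj).1
  have e1 : m + 1 + (i + 1) - 1 = m + i + 1 := by omega
  have e2 : m + (i + 1) - 1 = m + i := by omega
  rw [e1, e2, eulerTrunc_succ, eulerTrunc_succ m, eulerTrunc_nil, eulerTrunc_nil]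
  push_cast
  ring

/-- Partial fractions for `1 / (j (m + j))`. The terms are grouped so that for `z = -1` the two
divergent harmonic sums occur only through their convergent difference. -/
theorem sum_alt_increment_kernel (z : ℤˣ) {m : ℕ} (hm : 1 ≤ m) (N : ℕ) :
    ∑ j ∈ Icc 1 N, (-1 : ℝ) ^ j / (j : ℝ) * (((z : ℤ) : ℝ) ^ (m + j) / ((m : ℝ) + j)) =
      ((z : ℤ) : ℝ) ^ m / m * ((eulerTrunc N [(1, -z)] -
        (((-z : ℤˣ) : ℤ) : ℝ) ^ m * eulerTrunc (m + N) [(1, -z)]) +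
        (((-z : ℤˣ) : ℤ) : ℝ) ^ m * eulerTrunc m [(1, -z)]) := by
  have h1 := sum_Ioc_eq_eulerTrunc_sub (-z) (Nat.le_add_right m N)
  rw [sum_Ioc_shift (fun k => (((-z : ℤˣ) : ℤ) : ℝ) ^ k / (k : ℝ)), Nat.add_sub_cancel_left] at h1
  have h2 : ∀ a b c d : ℝ, a * ((b - c * d) + c * eulerTrunc m [(1, -z)]) =
    a * (b - c * (d - eulerTrunc m [(1, -z)])) := fun a b c d => by ring
  rw [h2, ← h1, eulerTrunc_one, mul_sum, ← sum_sub_distrib, mul_sum]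
  refine sum_congr rfl fun j hj => ?_
  have hj0 : (j : ℝ) ≠ 0 := by have := (mem_Icc.1 hj).1; positivity
  have hm0 : (m : ℝ) ≠ 0 := by positivity
  have hmj : (m : ℝ) + j ≠ 0 := by positivity
  have hz := sign_pow_mul_self z m
  have hs := sign_pow_mul_self (-1) m
  push_cast at hs ⊢
  rw [neg_pow ((z : ℤ) : ℝ) m, neg_pow ((z : ℤ) : ℝ) j, neg_pow ((z : ℤ) : ℝ) (m + j), pow_add,
    pow_add]
  field_simp
  linear_combination ((-1 : ℝ) ^ m * (-1 : ℝ) ^ m * j) * hz + j * hs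

/-- Induction through `altIncrement_succ`. It starts at `1` because the passage from `0` to `1` has
kernel `1 / j^2`, giving `ζ(2; -z)`, where the partial fractions break down. -/
theorem tendsto_altIncrement (z : ℤˣ) (m : ℕ) :
    Tendsto (altIncrement z (m + 1)) atTop (𝓝 (eulerSum [bar 1, (1, z)] + eulerSum [(2, -z)] -
      eulerSum [bar 1] * (((z : ℤ) : ℝ) ^ (m + 1) / ((m : ℝ) + 1)) -
      eulerSum [bar 1] * eulerTrunc m [bar 1] + eulerTrunc m [bar 1, (1, -z)] +
      eulerTrunc m [(2, z)])) := by
  induction m with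
  | zero =>
    have h1 : Admissible [bar 1, (1, z)] := by simp [Admissible]
    have h2 : Admissible [(2, -z)] := by simp [Admissible]
    have := (h1.tendsto.add h2.tendsto).sub
      (admissible_bar_one.tendsto.mul_const (((z : ℤ) : ℝ) ^ (0 + 1) / (((0 : ℕ) : ℝ) + 1)))
    simp only [eulerTrunc_zero, mul_zero, sub_zero, add_zero]
    refine this.congr fun N => ?_
    rw [altIncrement_succ, altIncrement_zero, mul_comm (eulerTrunc N [bar 1])]
    congr 2
    simp only [eulerTrunc, mul_one]
    refine sum_congr rfl fun j hj => ?_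
    push_cast
    rw [neg_pow]
    simp only [zero_add]
    ring
  | succ m ih =>
    have h1 := tendsto_eulerTrunc_sub_sign_mul (-z) (m + 1)
    have h2 := (ih.add ((h1.add_const ((((-z : ℤˣ) : ℤ) : ℝ) ^ (m + 1) *
      eulerTrunc (m + 1) [(1, -z)])).const_mul (((z : ℤ) : ℝ) ^ (m + 1) / ((m + 1 : ℕ) : ℝ)))).sub
      (admissible_bar_one.tendsto.const_mul
        (((z : ℤ) : ℝ) ^ (m + 1 + 1) / (((m + 1 : ℕ) : ℝ) + 1)))
    have h3 := h2.congr (f₂ := altIncrement z (m + 1 + 1)) fun N => by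
      rw [altIncrement_succ z (m + 1), sum_alt_increment_kernel z (by omega)]
    convert h3 using 2
    have hz := sign_pow_mul_self z (m + 1)
    have hs := sign_pow_mul_self (-1) (m + 1)
    rw [eulerTrunc_succ, eulerTrunc_succ, eulerTrunc_succ, eulerTrunc_succ, eulerTrunc_nil]
    push_cast at hs ⊢
    rw [neg_pow ((z : ℤ) : ℝ) (m + 1)]
    rw [pow_succ ((z : ℤ) : ℝ) (m + 1)]
    generalize ((z : ℤ) : ℝ) ^ (m + 1) = x at *
    generalize (-1 : ℝ) ^ (m + 1) = s at *
    generalize (m : ℝ) + 1 = q at *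
    generalize eulerTrunc m [(1, -z)] = t at *
    linear_combination (eulerSum [bar 1] * s / q - s * t / q - x * s * s / q ^ 2) * hz -
      x / q ^ 2 * hs

/-- The sum over the two outer variables, for outermost sign `-1`. -/
noncomputable def innerBar (z : ℤˣ) (m M : ℕ) : ℝ :=
  ∑ k ∈ Ioc m M, ((z : ℤ) : ℝ) ^ k / (k : ℝ) * ∑ n ∈ Ioc k M, (-1 : ℝ) ^ n / ((n : ℝ) - m)

theorem innerBar_eq (z : ℤˣ) (m M : ℕ) :
    innerBar z m M = (-1 : ℝ) ^ m * altIncrement z m (M - m) := by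
  simp only [innerBar, mul_sum, altIncrement]
  -- With `n` outermost and `n = m + j`, the sum over `k` becomes a difference of depth-one sums and
  -- `n - m` becomes `j`.
  rw [sum_comm' (t' := Ioc m M) (s' := fun n => Ioc m (n - 1))
    (by intro k n; simp only [mem_Ioc]; omega), sum_Ioc_shift]
  refine sum_congr rfl fun j hj => ?_
  have hj1 := (mem_Icc.1 hj).1
  rw [← sum_mul, sum_Ioc_eq_eulerTrunc_sub z (by omega), pow_add]
  push_cast
  rw [add_sub_cancel_left]
  ring

theorem abs_innerBar_le (z : ℤˣ) (m M : ℕ) :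
    |innerBar z m M| ≤ ∑ k ∈ Ioc m M, 1 / (k : ℝ) * (1 / ((k : ℝ) - m)) := by
  refine (abs_sum_le_sum_abs _ _).trans (sum_le_sum fun k hk => ?_)
  rw [abs_mul, abs_div, abs_sign_pow, Nat.abs_cast]
  exact mul_le_mul_of_nonneg_left (abs_sum_alternating_le M (mem_Ioc.1 hk).1) (by positivity)

theorem tendsto_innerBar (z : ℤˣ) {m : ℕ} (hm : 1 ≤ m) :
    Tendsto (innerBar z m) atTop (𝓝 ((-1 : ℝ) ^ m * (eulerSum [bar 1, (1, z)] +
      eulerSum [(2, -z)] - eulerSum [bar 1] * (((z : ℤ) : ℝ) ^ m / (m : ℝ)) -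
      eulerSum [bar 1] * eulerTrunc (m - 1) [bar 1] + eulerTrunc (m - 1) [bar 1, (1, -z)] +
      eulerTrunc (m - 1) [(2, z)]))) := by
  obtain ⟨m, rfl⟩ := Nat.exists_eq_add_of_le' hm
  have h := ((tendsto_altIncrement z m).comp (tendsto_sub_atTop_nat (m + 1))).const_mul
    ((-1 : ℝ) ^ (m + 1))
  push_cast
  exact h.congr fun M => (innerBar_eq z (m + 1) M).symm

/-! ### Two relations of weight two -/

/-- The limit of the inner sum for fixed `m` is at most `K / √m`, hence vanishes as `m → ∞`. Its
explicit formula then yields a relation, which the stuffle square of `ζ(1̄)` simplifies. -/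
theorem eulerSum_bar_one_one_add : eulerSum [bar 1, pl 1] + eulerSum [bar 2] =
    eulerSum [bar 1, bar 1] := by
  obtain ⟨K, hK0, hK⟩ := exists_bound_sum_inv_mul_inv
  set G : ℕ → ℝ := fun m => eulerSum [bar 1, (1, 1)] + eulerSum [(2, -1)] -
      eulerSum [bar 1] * ((((1 : ℤˣ) : ℤ) : ℝ) ^ (m + 1) / ((m : ℝ) + 1)) -
      eulerSum [bar 1] * eulerTrunc m [bar 1] + eulerTrunc m [bar 1, (1, -1)] +
      eulerTrunc m [(2, 1)] with hG
  have hb : ∀ m, |G m| ≤ K / √((m + 1 : ℕ) : ℝ) := fun m => by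
    refine le_of_tendsto (tendsto_altIncrement 1 m).abs (Eventually.of_forall fun N => ?_)
    have h := (abs_innerBar_le 1 (m + 1) (N + (m + 1))).trans (hK (m + 1) (N + (m + 1)) (by omega))
    rwa [innerBar_eq, abs_mul, abs_pow, abs_neg, abs_one, one_pow, one_mul,
      Nat.add_sub_cancel] at h
  have hz : Tendsto (fun m : ℕ => K / √((m + 1 : ℕ) : ℝ)) atTop (𝓝 0) := by
    refine Tendsto.div_atTop tendsto_const_nhds ?_
    exact Real.tendsto_sqrt_atTop.comp (tendsto_natCast_atTop_atTop.comp (tendsto_add_atTop_nat 1))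
  have h0 : Tendsto G atTop (𝓝 0) := squeeze_zero_norm hb hz
  have a1 : Admissible [bar 1, bar 1] := by simp [Admissible]
  have a2 : Admissible [pl 2] := by simp [Admissible]
  have h1 : Tendsto G atTop (𝓝 (eulerSum [bar 1, pl 1] + eulerSum [bar 2] - eulerSum [bar 1] * 0 -
      eulerSum [bar 1] * eulerSum [bar 1] + eulerSum [bar 1, bar 1] + eulerSum [pl 2])) := by
    refine ((((tendsto_const_nhds).sub (Tendsto.const_mul _ ?_)).sub
      (admissible_bar_one.tendsto.const_mul _)).add a1.tendsto).add a2.tendsto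
    simpa using tendsto_one_div_add_atTop_nhds_zero_nat (𝕜 := ℝ)
  have h2 := tendsto_nhds_unique h0 h1
  have h3 := eulerSum_mul_depth_one admissible_bar_one admissible_bar_one (by simp [Admissible])
  simp only [mul_neg, mul_one, neg_neg, Nat.reduceAdd] at h3
  linear_combination -h2 + h3

theorem eulerSum_bar_two : 2 * eulerSum [bar 2] + eulerSum [pl 2] = 0 := by
  have a1 : Admissible [bar 2] := by simp [Admissible]
  have a2 : Admissible [pl 2] := by simp [Admissible]
  -- Adding the two sums cancels odd `n` and doubles even `n`.
  have hid : ∀ M, 2 * (eulerTrunc (2 * M) [bar 2] + eulerTrunc (2 * M) [pl 2]) =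
      eulerTrunc M [pl 2] := by
    intro M
    induction M with
    | zero => simp [eulerTrunc_zero]
    | succ M ih =>
      rw [show 2 * (M + 1) = 2 * M + 1 + 1 by ring, eulerTrunc_succ, eulerTrunc_succ,
        eulerTrunc_succ, eulerTrunc_succ, eulerTrunc_succ M, eulerTrunc_nil, ← ih, eulerTrunc_nil,
        eulerTrunc_nil]
      push_cast
      have hp : (-1 : ℝ) ^ (2 * M) = 1 := by simp [pow_mul]
      simp only [pow_succ (-1 : ℝ), hp]
      field_simp
      ring
  have ht : Tendsto (fun M : ℕ => 2 * M) atTop atTop :=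
    tendsto_id.const_mul_atTop' (by norm_num)
  have h := (((a1.tendsto.comp ht).add (a2.tendsto.comp ht)).const_mul 2).congr
    (f₂ := fun M => eulerTrunc M [pl 2]) fun M => hid M
  have := tendsto_nhds_unique h a2.tendsto
  linear_combination this

/-! ### Summation over the innermost variable, outermost sign `-1` -/

theorem sqrt_bound_of_weight {u : ℕ} (hu : 2 ≤ u) (z : ℤˣ) {K x : ℝ} (m : ℕ)
    (hx : 1 ≤ m → |x| ≤ K * √(m : ℝ)) :
    |((z : ℤ) : ℝ) ^ m / (m : ℝ) ^ u * x| ≤ K * (√(m : ℝ) / (m : ℝ) ^ 2) := by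
  -- At `m = 0` both sides are zero by the convention for division by zero.
  rcases Nat.eq_zero_or_pos m with rfl | hm
  · have : u ≠ 0 := by omega
    simp [this]
  have hm1 : (1 : ℝ) ≤ m := by exact_mod_cast hm
  rw [abs_mul, abs_div, abs_sign_pow, abs_of_nonneg (by positivity : (0 : ℝ) ≤ (m : ℝ) ^ u)]
  have h1 : 1 / (m : ℝ) ^ u ≤ 1 / (m : ℝ) ^ 2 :=
    one_div_le_one_div_of_le (by positivity) (pow_le_pow_right₀ hm1 hu)
  calc _ ≤ 1 / (m : ℝ) ^ 2 * (K * √(m : ℝ)) :=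
        mul_le_mul h1 (hx hm) (abs_nonneg _) (by positivity)
    _ = _ := by ring

theorem admissible_cons {s : ℕ} (hs : 2 ≤ s) (z : ℤˣ) {l : List SignedExp}
    (hl : ∀ a ∈ l, 1 ≤ a.1) : Admissible ((s, z) :: l) := by
  refine ⟨fun a ha => ?_, ?_⟩
  · rcases List.mem_cons.1 ha with rfl | ha
    · show 1 ≤ s; omega
    · exact hl a ha
  · simp only [List.head?_cons, ne_eq, Option.some.injEq, Prod.mk.injEq]
    omega

theorem tendsto_inner_part_bar (z₂ z₃ : ℤˣ) {u : ℕ} (hu : 2 ≤ u) :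
    Tendsto (fun M => tripleSum (fun k => ((z₂ : ℤ) : ℝ) ^ k / k)
        (fun n m => (((-1 : ℤˣ) : ℤ) : ℝ) ^ n * ((z₃ : ℤ) : ℝ) ^ m *
          (1 / ((m : ℝ) ^ u * ((n : ℝ) - m)))) M) atTop
      (𝓝 ((eulerSum [bar 1, (1, z₂)] + eulerSum [(2, -z₂)]) * eulerSum [(u, -z₃)] -
        eulerSum [bar 1] * eulerSum [(u + 1, -z₃ * z₂)] -
        eulerSum [bar 1] * eulerSum [(u, -z₃), bar 1] + eulerSum [(u, -z₃), bar 1, (1, -z₂)] +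
        eulerSum [(u, -z₃), (2, z₂)])) := by
  have hF : ∀ M, tripleSum (fun k => ((z₂ : ℤ) : ℝ) ^ k / k)
        (fun n m => (((-1 : ℤˣ) : ℤ) : ℝ) ^ n * ((z₃ : ℤ) : ℝ) ^ m *
          (1 / ((m : ℝ) ^ u * ((n : ℝ) - m)))) M =
      ∑ m ∈ Icc 1 M, ((z₃ : ℤ) : ℝ) ^ m / (m : ℝ) ^ u * innerBar z₂ m M := by
    intro M
    rw [tripleSum_eq_sum_inner]
    simp only [innerBar, mul_sum]
    refine sum_congr rfl fun m _ => sum_congr rfl fun k _ => sum_congr rfl fun n _ => ?_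
    rw [one_div, mul_inv]
    push_cast
    ring
  simp only [hF]
  obtain ⟨K, hK0, hK⟩ := exists_bound_sum_inv_mul_inv
  refine tendsto_sum_of_dominated (summable_sqrt_div_sq.mul_left K)
    (fun m M => sqrt_bound_of_weight hu z₃ m fun hm => ?_)
    (fun m hm => (tendsto_innerBar z₂ hm).const_mul _) ?_
  · refine (abs_innerBar_le z₂ m M).trans ((hK m M hm).trans ?_)
    -- Here `K / √m` is weakened to `K * √m`, the size met for outermost sign `1`, so that one
    -- weight estimate serves both cases.
    have h1 : (1 : ℝ) ≤ √(m : ℝ) := Real.one_le_sqrt.2 (by exact_mod_cast hm)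
    rw [div_le_iff₀ (by linarith)]
    nlinarith [mul_le_mul h1 h1 zero_le_one (by linarith)]
  · have e : ∀ M, (eulerSum [bar 1, (1, z₂)] + eulerSum [(2, -z₂)]) * eulerTrunc M [(u, -z₃)] -
        eulerSum [bar 1] * eulerTrunc M [(u + 1, -z₃ * z₂)] -
        eulerSum [bar 1] * eulerTrunc M [(u, -z₃), bar 1] +
        eulerTrunc M [(u, -z₃), bar 1, (1, -z₂)] + eulerTrunc M [(u, -z₃), (2, z₂)] =
        ∑ m ∈ Icc 1 M, ((z₃ : ℤ) : ℝ) ^ m / (m : ℝ) ^ u * ((-1 : ℝ) ^ m *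
          (eulerSum [bar 1, (1, z₂)] +
          eulerSum [(2, -z₂)] - eulerSum [bar 1] * (((z₂ : ℤ) : ℝ) ^ m / (m : ℝ)) -
          eulerSum [bar 1] * eulerTrunc (m - 1) [bar 1] + eulerTrunc (m - 1) [bar 1, (1, -z₂)] +
          eulerTrunc (m - 1) [(2, z₂)])) := by
      intro M
      induction M with
      | zero => simp [eulerTrunc_zero]
      | succ M ih =>
        rw [Finset.sum_Icc_succ_top (by omega), ← ih, Nat.add_sub_cancel]
        simp only [eulerTrunc_succ M u, eulerTrunc_succ M (u + 1), eulerTrunc_nil]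
        push_cast
        simp only [mul_pow, neg_pow ((z₃ : ℤ) : ℝ) (M + 1)]
        generalize (M : ℝ) + 1 = q
        ring
    refine Tendsto.congr e ?_
    have hu' : 2 ≤ u + 1 := by omega
    refine (((((admissible_cons hu _ ?_).tendsto.const_mul _).sub
      ((admissible_cons hu' _ ?_).tendsto.const_mul _)).sub
      ((admissible_cons hu _ ?_).tendsto.const_mul _)).add
      (admissible_cons hu _ ?_).tendsto).add (admissible_cons hu _ ?_).tendsto <;> simp

/-! ### The inner sums for outermost sign `1` -/

/-- The sum of `1 / n` over `k - m < n ≤ k`. -/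
noncomputable def harmonicGap (m k : ℕ) : ℝ := eulerTrunc k [pl 1] - eulerTrunc (k - m) [pl 1]

theorem harmonicGap_eq_sum (m k : ℕ) :
    harmonicGap m k = ∑ n ∈ Ioc (k - m) k, 1 / (n : ℝ) := by
  rw [harmonicGap, ← sum_Ioc_eq_eulerTrunc_sub 1 (Nat.sub_le k m)]
  simp

theorem harmonicGap_nonneg (m k : ℕ) : 0 ≤ harmonicGap m k := by
  rw [harmonicGap_eq_sum]
  exact sum_nonneg fun n _ => by positivity

theorem harmonicGap_le {m k : ℕ} (h : m < k) : harmonicGap m k ≤ m * (1 / ((k : ℝ) - m)) := by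
  have hmk : (m : ℝ) < k := by exact_mod_cast h
  rw [harmonicGap_eq_sum]
  refine (sum_le_card_nsmul _ _ (1 / ((k : ℝ) - m)) fun n hn => ?_).trans_eq ?_
  · have : ((k - m : ℕ) : ℝ) ≤ n := by exact_mod_cast (mem_Ioc.1 hn).1.le
    rw [Nat.cast_sub h.le] at this
    exact one_div_le_one_div_of_le (by linarith) this
  · rw [Nat.card_Ioc, nsmul_eq_mul, Nat.sub_sub_self h.le]

theorem harmonicGap_succ_left {m k : ℕ} (h : m < k) :
    harmonicGap (m + 1) k = harmonicGap m k + 1 / ((k : ℝ) - m) := by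
  obtain ⟨j, rfl⟩ := Nat.exists_eq_add_of_lt h
  have e1 : m + j + 1 - (m + 1) = j := by omega
  have e2 : m + j + 1 - m = j + 1 := by omega
  rw [harmonicGap, harmonicGap, e1, e2, eulerTrunc_succ j, eulerTrunc_nil]
  have e3 : ((m + j + 1 : ℕ) : ℝ) - m = j + 1 := by push_cast; ring
  rw [e3]
  simp
  ring

/-- The sum over the two outer variables, for outermost sign `1`, with the terms for which the
outermost exponent is `1` removed. -/
noncomputable def innerPl (z : ℤˣ) (m M : ℕ) : ℝ :=
  ∑ k ∈ Ioc m M, ((z : ℤ) : ℝ) ^ k / (k : ℝ) * ∑ n ∈ Ioc k M, (1 / ((n : ℝ) - m) - 1 / (n : ℝ))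

theorem sum_Ioc_gap {m k M : ℕ} (h : m ≤ k) (hM : k ≤ M) :
    ∑ n ∈ Ioc k M, (1 / ((n : ℝ) - m) - 1 / (n : ℝ)) = harmonicGap m k - harmonicGap m M := by
  induction M, hM using Nat.le_induction with
  | base => simp
  | succ M hM ih =>
    rw [Finset.sum_Ioc_succ_top (by omega), ih]
    obtain ⟨j, rfl⟩ := Nat.exists_eq_add_of_le (h.trans hM)
    have e1 : m + j + 1 - m = j + 1 := by omega
    have e2 : m + j - m = j := by omega
    rw [harmonicGap, harmonicGap, harmonicGap, e1, e2, eulerTrunc_succ, eulerTrunc_succ j,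
      eulerTrunc_nil, eulerTrunc_nil]
    have e3 : ((m + j + 1 : ℕ) : ℝ) - m = j + 1 := by push_cast; ring
    rw [e3]
    push_cast
    simp
    ring

theorem innerPl_eq (z : ℤˣ) (m M : ℕ) :
    innerPl z m M = ∑ k ∈ Ioc m M, ((z : ℤ) : ℝ) ^ k / (k : ℝ) *
      (harmonicGap m k - harmonicGap m M) := by
  refine sum_congr rfl fun k hk => ?_
  rw [mem_Ioc] at hk
  rw [sum_Ioc_gap hk.1.le hk.2]

/-- The telescoped sum over `n` lies between `0` and `harmonicGap m k ≤ m / (k - m)`. -/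
theorem abs_innerPl_le (z : ℤˣ) (m M : ℕ) :
    |innerPl z m M| ≤ m * ∑ k ∈ Ioc m M, 1 / (k : ℝ) * (1 / ((k : ℝ) - m)) := by
  rw [innerPl_eq, mul_sum]
  refine (abs_sum_le_sum_abs _ _).trans (sum_le_sum fun k hk => ?_)
  rw [mem_Ioc] at hk
  have h0 : 0 ≤ harmonicGap m k - harmonicGap m M := by
    rw [← sum_Ioc_gap hk.1.le hk.2]
    refine sum_nonneg fun n hn => sub_nonneg.2 (one_div_le_one_div_of_le ?_ ?_)
    · have : (m : ℝ) < n := by exact_mod_cast hk.1.trans (mem_Ioc.1 hn).1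
      linarith
    · have : (0 : ℝ) ≤ m := by positivity
      linarith
  have h1 := harmonicGap_le hk.1
  have h2 := harmonicGap_nonneg m M
  rw [abs_mul, abs_div, abs_sign_pow, Nat.abs_cast, abs_of_nonneg h0]
  calc _ ≤ 1 / (k : ℝ) * (m * (1 / ((k : ℝ) - m))) :=
        mul_le_mul_of_nonneg_left (by linarith) (by positivity)
    _ = _ := by ring

theorem tendsto_harmonic_div : Tendsto (fun M : ℕ => (harmonic M : ℝ) / M) atTop (𝓝 0) := by
  have h := (harmonic_pow_isLittleO 1 1 one_pos).tendsto_div_nhds_zero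
  rw [← tendsto_add_atTop_iff_nat 1]
  refine h.congr fun M => ?_
  rw [Real.rpow_one, pow_one]
  push_cast
  rfl

/-- For fixed `m` the gap is `O(1 / M)`, while the depth-one sum grows at most like the harmonic
number. -/
theorem tendsto_harmonicGap_mul (z : ℤˣ) (m : ℕ) :
    Tendsto (fun M => harmonicGap m M * eulerTrunc M [(1, z)]) atTop (𝓝 0) := by
  have h := tendsto_harmonic_div.const_mul ((m : ℝ) * (m + 1))
  rw [mul_zero] at h
  refine squeeze_zero_norm' ?_ h
  filter_upwards [eventually_gt_atTop m] with M hM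
  have h1 := harmonicGap_le hM
  have h2 := abs_eulerTrunc_le [(1, z)] (by simp) M
  have h3 : 1 / ((M : ℝ) - m) ≤ (m + 1) / M := by
    obtain ⟨j, rfl⟩ := Nat.exists_eq_add_of_lt hM
    push_cast
    rw [div_le_div_iff₀ (by ring_nf; positivity) (by positivity)]
    have : (0 : ℝ) ≤ m * j := by positivity
    nlinarith
  rw [Real.norm_eq_abs, abs_mul, abs_of_nonneg (harmonicGap_nonneg m M)]
  simp only [List.length_singleton, pow_one] at h2
  calc _ ≤ (m * ((m + 1) / M)) * (harmonic M : ℝ) :=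
        mul_le_mul (h1.trans (mul_le_mul_of_nonneg_left h3 (by positivity))) h2 (abs_nonneg _)
          (by positivity)
    _ = _ := by ring

theorem tendsto_harmonicGap (m : ℕ) : Tendsto (harmonicGap m) atTop (𝓝 0) := by
  have h := tendsto_harmonicGap_mul 1 m
  refine squeeze_zero' (Eventually.of_forall fun M => harmonicGap_nonneg m M) ?_ h
  filter_upwards [eventually_ge_atTop 1] with M hM
  refine le_mul_of_one_le_right (harmonicGap_nonneg m M) ?_
  rw [eulerTrunc_one]
  have := single_le_sum (f := fun n : ℕ => (((1 : ℤˣ) : ℤ) : ℝ) ^ n / (n : ℝ))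
    (s := Icc 1 M) (fun n _ => by simp) (mem_Icc.2 ⟨le_rfl, hM⟩)
  simpa using this

/-- The part of `innerPl` that contributes to its limit. -/
noncomputable def gapSum (z : ℤˣ) (m M : ℕ) : ℝ :=
  ∑ k ∈ Ioc m M, ((z : ℤ) : ℝ) ^ k / (k : ℝ) * harmonicGap m k

theorem gapSum_zero (z : ℤˣ) (M : ℕ) : gapSum z 0 M = 0 := by
  simp [gapSum, harmonicGap]

/-- Raising `m` lengthens every gap by `1 / (k - m)` and drops the term `k = m + 1`, whose gap is
then a full harmonic number. -/
theorem gapSum_succ (z : ℤˣ) {m M : ℕ} (h : m < M) :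
    gapSum z (m + 1) M = gapSum z m M +
      ∑ k ∈ Ioc m M, ((z : ℤ) : ℝ) ^ k / (k : ℝ) * (1 / ((k : ℝ) - m)) -
      ((z : ℤ) : ℝ) ^ (m + 1) / ((m : ℝ) + 1) * eulerTrunc (m + 1) [pl 1] := by
  have h1 : ∑ k ∈ Ioc m M, ((z : ℤ) : ℝ) ^ k / (k : ℝ) * harmonicGap (m + 1) k = gapSum z m M +
      ∑ k ∈ Ioc m M, ((z : ℤ) : ℝ) ^ k / (k : ℝ) * (1 / ((k : ℝ) - m)) := by
    rw [gapSum, ← sum_add_distrib]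
    refine sum_congr rfl fun k hk => ?_
    rw [harmonicGap_succ_left (mem_Ioc.1 hk).1]
    ring
  rw [← h1, ← Finset.sum_Ioc_consecutive _ (Nat.le_succ m) h, Nat.Ioc_succ_singleton, sum_singleton,
    gapSum, harmonicGap, Nat.sub_self, eulerTrunc_zero]
  push_cast
  ring

/-- Partial fractions `1 / (k (k - m)) = (1 / (k - m) - 1 / k) / m`, grouped again so that only
convergent differences occur. -/
theorem tendsto_gap_kernel (z : ℤˣ) {m : ℕ} (hm : 1 ≤ m) :
    Tendsto (fun M => ∑ k ∈ Ioc m M, ((z : ℤ) : ℝ) ^ k / (k : ℝ) * (1 / ((k : ℝ) - m))) atTop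
      (𝓝 (1 / (m : ℝ) * ((((z : ℤ) : ℝ) ^ m - 1) * eulerSum [bar 1] + eulerTrunc m [(1, z)]))) := by
  have hz := sign_pow_mul_self z m
  have h := ((((tendsto_eulerTrunc_sub_sign_mul z m).comp (tendsto_sub_atTop_nat m)).const_mul
    (((z : ℤ) : ℝ) ^ m)).add_const (eulerTrunc m [(1, z)])).const_mul (1 / (m : ℝ))
  have e : ((z : ℤ) : ℝ) ^ m * ((1 - ((z : ℤ) : ℝ) ^ m) * eulerSum [bar 1]) =
      (((z : ℤ) : ℝ) ^ m - 1) * eulerSum [bar 1] := by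
    linear_combination (-eulerSum [bar 1]) * hz
  rw [e] at h
  refine h.congr' ?_
  filter_upwards [eventually_ge_atTop m] with M hM
  obtain ⟨N, rfl⟩ := Nat.exists_eq_add_of_le hM
  have hm0 : (m : ℝ) ≠ 0 := by positivity
  have h1 := sum_Ioc_eq_eulerTrunc_sub z hM
  rw [sum_Ioc_shift (fun k => ((z : ℤ) : ℝ) ^ k / (k : ℝ))] at h1
  rw [sum_Ioc_shift (fun k => ((z : ℤ) : ℝ) ^ k / (k : ℝ) * (1 / ((k : ℝ) - m)))]
  simp only [Function.comp, Nat.add_sub_cancel_left] at h1 ⊢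
  have h2 : ((z : ℤ) : ℝ) ^ m * (eulerTrunc N [(1, z)] - ((z : ℤ) : ℝ) ^ m *
      eulerTrunc (m + N) [(1, z)]) + eulerTrunc m [(1, z)] =
      ((z : ℤ) : ℝ) ^ m * eulerTrunc N [(1, z)] -
        (eulerTrunc (m + N) [(1, z)] - eulerTrunc m [(1, z)]) := by
    linear_combination (-eulerTrunc (m + N) [(1, z)]) * hz
  rw [h2, ← h1, eulerTrunc_one, mul_sum, ← sum_sub_distrib, mul_sum]
  refine sum_congr rfl fun j hj => ?_
  have hj0 : (j : ℝ) ≠ 0 := by have := (mem_Icc.1 hj).1; positivity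
  have hmj : (m : ℝ) + j ≠ 0 := by positivity
  push_cast
  rw [add_sub_cancel_left, pow_add]
  field_simp
  ring

theorem tendsto_gapSum (z : ℤˣ) (m : ℕ) :
    Tendsto (gapSum z (m + 1)) atTop (𝓝 (eulerSum [(2, z)] +
      eulerSum [bar 1] * (eulerTrunc m [(1, z)] - eulerTrunc m [pl 1]) +
      eulerTrunc m [pl 1, (1, z)] - eulerTrunc m [(1, z), pl 1] -
      ((z : ℤ) : ℝ) ^ (m + 1) / ((m : ℝ) + 1) * eulerTrunc m [pl 1] -
      ((z : ℤ) : ℝ) ^ (m + 1) / ((m : ℝ) + 1) ^ 2)) := by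
  induction m with
  | zero =>
    have h2 : Admissible [(2, z)] := by simp [Admissible]
    have h := h2.tendsto.sub_const ((z : ℤ) : ℝ)
    have e : eulerSum [(2, z)] +
      eulerSum [bar 1] * (eulerTrunc 0 [(1, z)] - eulerTrunc 0 [pl 1]) +
      eulerTrunc 0 [pl 1, (1, z)] - eulerTrunc 0 [(1, z), pl 1] -
      ((z : ℤ) : ℝ) ^ (0 + 1) / (((0 : ℕ) : ℝ) + 1) * eulerTrunc 0 [pl 1] -
      ((z : ℤ) : ℝ) ^ (0 + 1) / (((0 : ℕ) : ℝ) + 1) ^ 2 = eulerSum [(2, z)] - ((z : ℤ) : ℝ) := by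
      simp [eulerTrunc_zero]
    rw [e]
    refine h.congr' ?_
    filter_upwards [eventually_gt_atTop 0] with M hM
    rw [gapSum_succ z hM, gapSum_zero, eulerTrunc_succ, eulerTrunc_zero, eulerTrunc_nil]
    have h1 : eulerTrunc M [(2, z)] =
        ∑ k ∈ Ioc 0 M, ((z : ℤ) : ℝ) ^ k / (k : ℝ) * (1 / ((k : ℝ) - (0 : ℕ))) := by
      simp only [eulerTrunc, mul_one]
      refine sum_congr rfl fun k _ => ?_
      push_cast
      ring
    rw [h1]
    simp
  | succ m ih =>
    have h := (ih.add (tendsto_gap_kernel z (m := m + 1) (by omega))).sub_const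
      (((z : ℤ) : ℝ) ^ (m + 1 + 1) / (((m + 1 : ℕ) : ℝ) + 1) * eulerTrunc (m + 1 + 1) [pl 1])
    have h3 := h.congr' (f₂ := gapSum z (m + 1 + 1)) (by
      filter_upwards [eventually_gt_atTop (m + 1)] with M hM
      rw [gapSum_succ z hM])
    convert h3 using 2
    simp only [eulerTrunc_succ, eulerTrunc_nil]
    push_cast
    rw [one_pow, one_pow]
    generalize (m : ℝ) + 1 = q
    generalize q + 1 = r
    ring

theorem tendsto_innerPl (z : ℤˣ) {m : ℕ} (hm : 1 ≤ m) :
    Tendsto (innerPl z m) atTop (𝓝 (eulerSum [(2, z)] +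
      eulerSum [bar 1] * (eulerTrunc (m - 1) [(1, z)] - eulerTrunc (m - 1) [pl 1]) +
      eulerTrunc (m - 1) [pl 1, (1, z)] - eulerTrunc (m - 1) [(1, z), pl 1] -
      ((z : ℤ) : ℝ) ^ m / (m : ℝ) * eulerTrunc (m - 1) [pl 1] -
      ((z : ℤ) : ℝ) ^ m / (m : ℝ) ^ 2)) := by
  obtain ⟨m, rfl⟩ := Nat.exists_eq_add_of_le' hm
  -- The part of `innerPl` carrying `harmonicGap (m + 1) M` is a boundary term tending to zero.
  have h := (tendsto_gapSum z m).sub ((tendsto_harmonicGap_mul z (m + 1)).sub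
    ((tendsto_harmonicGap (m + 1)).mul_const (eulerTrunc (m + 1) [(1, z)])))
  rw [zero_mul, sub_zero, sub_zero] at h
  push_cast
  refine h.congr' ?_
  filter_upwards [eventually_ge_atTop (m + 1)] with M hM
  rw [innerPl_eq, gapSum, ← mul_sub, ← sum_Ioc_eq_eulerTrunc_sub z hM, mul_sum, ← sum_sub_distrib]
  exact sum_congr rfl fun k _ => by ring

/-! ### Summation over the innermost variable, outermost sign `1` -/

theorem tendsto_inner_part_pl (z₂ z₃ : ℤˣ) {u : ℕ} (hu : 2 ≤ u) :
    Tendsto (fun M => tripleSum (fun k => ((z₂ : ℤ) : ℝ) ^ k / k)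
        (fun n m => (((1 : ℤˣ) : ℤ) : ℝ) ^ n * ((z₃ : ℤ) : ℝ) ^ m *
          (1 / ((m : ℝ) ^ u * ((n : ℝ) - m)))) M - eulerTrunc M [(1, 1), (1, z₂), (u, z₃)]) atTop
      (𝓝 (eulerSum [(2, z₂)] * eulerSum [(u, z₃)] - eulerSum [(u + 2, z₃ * z₂)] +
        eulerSum [bar 1] * (eulerSum [(u, z₃), (1, z₂)] - eulerSum [(u, z₃), pl 1]) -
        eulerSum [(u, z₃), (1, z₂), pl 1] + eulerSum [(u, z₃), pl 1, (1, z₂)] -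
        eulerSum [(u + 1, z₃ * z₂), pl 1])) := by
  have hF : ∀ M, tripleSum (fun k => ((z₂ : ℤ) : ℝ) ^ k / k)
        (fun n m => (((1 : ℤˣ) : ℤ) : ℝ) ^ n * ((z₃ : ℤ) : ℝ) ^ m *
          (1 / ((m : ℝ) ^ u * ((n : ℝ) - m)))) M - eulerTrunc M [(1, 1), (1, z₂), (u, z₃)] =
      ∑ m ∈ Icc 1 M, ((z₃ : ℤ) : ℝ) ^ m / (m : ℝ) ^ u * innerPl z₂ m M := by
    intro M
    rw [eulerTrunc_eq_tripleSum, ← tripleSum_sub, tripleSum_eq_sum_inner]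
    simp only [innerPl, mul_sum]
    refine sum_congr rfl fun m _ => sum_congr rfl fun k _ => sum_congr rfl fun n _ => ?_
    rw [one_div ((m : ℝ) ^ u * _), mul_inv]
    push_cast
    simp only [one_pow, inv_pow, pow_one]
    ring
  simp only [hF]
  obtain ⟨K, hK0, hK⟩ := exists_bound_sum_inv_mul_inv
  refine tendsto_sum_of_dominated (summable_sqrt_div_sq.mul_left K)
    (fun m M => sqrt_bound_of_weight hu z₃ m fun hm => ?_)
    (fun m hm => (tendsto_innerPl z₂ hm).const_mul _) ?_
  · refine (abs_innerPl_le z₂ m M).trans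
      ((mul_le_mul_of_nonneg_left (hK m M hm) (by positivity)).trans_eq ?_)
    rw [mul_div_left_comm, Real.div_sqrt]
  · have e : ∀ M, eulerSum [(2, z₂)] * eulerTrunc M [(u, z₃)] - eulerTrunc M [(u + 2, z₃ * z₂)] +
        eulerSum [bar 1] * (eulerTrunc M [(u, z₃), (1, z₂)] - eulerTrunc M [(u, z₃), pl 1]) -
        eulerTrunc M [(u, z₃), (1, z₂), pl 1] + eulerTrunc M [(u, z₃), pl 1, (1, z₂)] -
        eulerTrunc M [(u + 1, z₃ * z₂), pl 1] =
        ∑ m ∈ Icc 1 M, ((z₃ : ℤ) : ℝ) ^ m / (m : ℝ) ^ u * (eulerSum [(2, z₂)] +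
          eulerSum [bar 1] * (eulerTrunc (m - 1) [(1, z₂)] - eulerTrunc (m - 1) [pl 1]) +
          eulerTrunc (m - 1) [pl 1, (1, z₂)] - eulerTrunc (m - 1) [(1, z₂), pl 1] -
          ((z₂ : ℤ) : ℝ) ^ m / (m : ℝ) * eulerTrunc (m - 1) [pl 1] -
          ((z₂ : ℤ) : ℝ) ^ m / (m : ℝ) ^ 2) := by
      intro M
      induction M with
      | zero => simp [eulerTrunc_zero]
      | succ M ih =>
        rw [Finset.sum_Icc_succ_top (by omega), ← ih, Nat.add_sub_cancel]
        simp only [eulerTrunc_succ M u, eulerTrunc_succ M (u + 1), eulerTrunc_succ M (u + 2),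
          eulerTrunc_nil]
        push_cast
        simp only [mul_pow]
        generalize (M : ℝ) + 1 = q
        ring
    refine Tendsto.congr e ?_
    have hu1 : 2 ≤ u + 1 := by omega
    have hu2 : 2 ≤ u + 2 := by omega
    refine ((((((admissible_cons hu _ ?_).tendsto.const_mul _).sub
      (admissible_cons hu2 _ ?_).tendsto).add
      (((admissible_cons hu _ ?_).tendsto.sub (admissible_cons hu _ ?_).tendsto).const_mul _)).sub
      (admissible_cons hu _ ?_).tendsto).add (admissible_cons hu _ ?_).tendsto).sub
      (admissible_cons hu1 _ ?_).tendsto <;> simp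

/-! ### Evaluation of the sums -/

theorem tendsto_outer_part (z₁ z₂ z₃ : ℤˣ) {u : ℕ} (hu : 2 ≤ u) :
    Tendsto (fun M => tripleSum (fun k => ((z₂ : ℤ) : ℝ) ^ k / k)
        (fun n m => ((z₁ : ℤ) : ℝ) ^ n * ((z₃ : ℤ) : ℝ) ^ m *
          (1 / ((n : ℝ) ^ u * ((n : ℝ) - m)))) M) atTop
      (𝓝 (eulerSum [(u, z₁ * z₃), (1, z₂), (1, z₃)] +
      eulerSum [(u, z₁ * z₃), (1, z₃), (1, z₂)] +
      eulerSum [(u, z₁ * z₃), (2, z₂ * z₃)] -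
      eulerSum [(u, z₁ * z₃), (1, z₂), (1, z₂ * z₃)] -
      eulerSum [(u, z₁ * z₃), (1, z₃), (1, z₂ * z₃)] -
      eulerSum [(u + 1, z₁ * z₃ * z₂), (1, z₂ * z₃)] -
      eulerSum [(u + 1, z₁), (1, z₂ * z₃)])) := by
  have hu' : 2 ≤ u + 1 := by omega
  simp only [tripleSum_outer, outer_part_eq]
  refine (((((((admissible_cons hu _ ?_).tendsto.add
    (admissible_cons hu _ ?_).tendsto).add (admissible_cons hu _ ?_).tendsto).sub
    (admissible_cons hu _ ?_).tendsto).sub (admissible_cons hu _ ?_).tendsto).sub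
    (admissible_cons hu' _ ?_).tendsto).sub (admissible_cons hu' _ ?_).tendsto) <;> simp

theorem mem_posPairs {n : ℕ} {p : ℕ × ℕ} :
    p ∈ posPairs n ↔ p.1 + p.2 = n ∧ 1 ≤ p.1 ∧ 1 ≤ p.2 := by
  simp [posPairs, HasAntidiagonal.mem_antidiagonal]

theorem sum_eulerSum_bar (z₂ z₃ : ℤˣ) {u : ℕ} (hu : 2 ≤ u) :
    ∑ p ∈ posPairs (u + 1), eulerSum [bar p.1, (1, z₂), (p.2, z₃)] =
      ((eulerSum [bar 1, (1, z₂)] + eulerSum [(2, -z₂)]) * eulerSum [(u, -z₃)] -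
        eulerSum [bar 1] * eulerSum [(u + 1, -z₃ * z₂)] -
        eulerSum [bar 1] * eulerSum [(u, -z₃), bar 1] + eulerSum [(u, -z₃), bar 1, (1, -z₂)] +
        eulerSum [(u, -z₃), (2, z₂)]) -
      (eulerSum [(u, -z₃), (1, z₂), (1, z₃)] +
      eulerSum [(u, -z₃), (1, z₃), (1, z₂)] +
      eulerSum [(u, -z₃), (2, z₂ * z₃)] -
      eulerSum [(u, -z₃), (1, z₂), (1, z₂ * z₃)] -
      eulerSum [(u, -z₃), (1, z₃), (1, z₂ * z₃)] -
      eulerSum [(u + 1, -z₃ * z₂), (1, z₂ * z₃)] -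
      eulerSum [bar (u + 1), (1, z₂ * z₃)]) := by
  have h := (tendsto_inner_part_bar z₂ z₃ hu).sub (tendsto_outer_part (-1) z₂ z₃ hu)
  simp only [← sum_posPairs_eulerTrunc, neg_one_mul] at h
  refine tendsto_nhds_unique (tendsto_finsetSum _ fun p hp => Admissible.tendsto ?_) h
  rw [mem_posPairs] at hp
  refine ⟨?_, by simp⟩
  simpa using hp.2

theorem regStar_of_ne {a : SignedExp} (ha : a ≠ pl 1) (l : List SignedExp) :
    regStar (a :: l) = C (eulerSum (a :: l)) := by
  rw [regStar, dif_neg ha]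

theorem sum_regStar_pl (z₂ z₃ : ℤˣ) {u : ℕ} (hu : 2 ≤ u) :
    ∑ p ∈ posPairs (u + 1), regStar [pl p.1, (1, z₂), (p.2, z₃)] =
      regStar [pl 1, (1, z₂), (u, z₃)] +
      C ((eulerSum [(2, z₂)] * eulerSum [(u, z₃)] - eulerSum [(u + 2, z₃ * z₂)] +
        eulerSum [bar 1] * (eulerSum [(u, z₃), (1, z₂)] - eulerSum [(u, z₃), pl 1]) -
        eulerSum [(u, z₃), (1, z₂), pl 1] + eulerSum [(u, z₃), pl 1, (1, z₂)] -
        eulerSum [(u + 1, z₃ * z₂), pl 1]) -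
      (eulerSum [(u, z₃), (1, z₂), (1, z₃)] +
      eulerSum [(u, z₃), (1, z₃), (1, z₂)] +
      eulerSum [(u, z₃), (2, z₂ * z₃)] -
      eulerSum [(u, z₃), (1, z₂), (1, z₂ * z₃)] -
      eulerSum [(u, z₃), (1, z₃), (1, z₂ * z₃)] -
      eulerSum [(u + 1, z₃ * z₂), (1, z₂ * z₃)] -
      eulerSum [pl (u + 1), (1, z₂ * z₃)])) := by
  have hmem : (1, u) ∈ posPairs (u + 1) := mem_posPairs.2 ⟨by simp [add_comm], by simp, by simp; omega⟩
  have h := (tendsto_inner_part_pl z₂ z₃ hu).sub (tendsto_outer_part 1 z₂ z₃ hu)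
  have hge : ∀ p ∈ (posPairs (u + 1)).erase (1, u), 2 ≤ p.1 ∧ 1 ≤ p.2 := by
    rintro ⟨a, c⟩ hp
    simp only [mem_erase, mem_posPairs, ne_eq, Prod.mk.injEq] at hp
    simp only
    omega
  -- The term `(1, u)` is the same polynomial on both sides; all others have outermost exponent at
  -- least `2`, so they are constants.
  rw [← add_sum_erase _ _ hmem]
  congr 1
  rw [sum_congr rfl fun p hp => regStar_of_ne (by have := (hge p hp).1; simp; omega)
    [(1, z₂), (p.2, z₃)], ← map_sum]
  congr 1
  refine tendsto_nhds_unique (tendsto_finsetSum _ fun p hp => Admissible.tendsto ?_)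
    (h.congr fun M => ?_) |>.trans ?_
  · exact admissible_cons (hge p hp).1 _ (by simpa using (hge p hp).2)
  · have h1 := sum_posPairs_eulerTrunc 1 z₂ z₃ u M
    rw [← add_sum_erase _ _ hmem] at h1
    linear_combination -h1
  · simp only [one_mul]

/-! ### The eight identities -/

theorem mainTheorem12 (w u v : ℕ) (hw : 4 ≤ w) (hu : u = w - 2) (hv : v = w - 1) :
    (∑ p ∈ posPairs (w - 1), regStar [pl p.1, pl 1, pl p.2] =
      regStar [pl 1, pl 1, pl u] + C (eulerSum [pl v, pl 1]) + C (eulerSum [pl 2, pl u])) ∧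
    (∑ p ∈ posPairs (w - 1), regStar [pl p.1, bar 1, bar p.2] =
      regStar [pl 1, bar 1, bar u] + C (eulerSum [bar 1, bar u, bar 1])
        - C (eulerSum [bar 1, bar u, pl 1]) + C (eulerSum [pl v, bar 1])
        + C (eulerSum [bar 2, bar u])) ∧
    (∑ p ∈ posPairs (w - 1), eulerSum [bar p.1, bar 1, pl p.2] =
      eulerSum [bar 1, bar 1, bar u] + eulerSum [pl 2, bar u] + eulerSum [bar v, bar 1]) ∧
    (∑ p ∈ posPairs (w - 1), eulerSum [bar p.1, pl 1, bar p.2] =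
      eulerSum [bar 1, pl u, pl 1] + eulerSum [bar 1, pl 1, pl u]
        - eulerSum [bar 1, pl u, bar 1] + eulerSum [bar v, pl 1] + eulerSum [bar 2, pl u]) ∧
    (∑ p ∈ posPairs (w - 1), eulerSum [bar p.1, pl 1, pl p.2] =
      eulerSum [bar 1, bar 1, bar u] + 2 * eulerSum [bar v, pl 1] + eulerSum [bar 1, pl v]
        - eulerSum [bar 1, bar v] - eulerSum [bar v, bar 1] - eulerSum [bar u, pl 2]
        - eulerSum [pl w]) ∧
    (∑ p ∈ posPairs (w - 1), regStar [pl p.1, pl 1, bar p.2] =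
      C (eulerSum [bar u, bar 1, bar 1]) - C (eulerSum [bar u, bar 1, pl 1])
        + regStar [pl 1, pl 1, bar u] - C (eulerSum [bar v, bar 1])
        + C (eulerSum [pl v, bar 1]) + 2 * C (eulerSum [bar v, bar 1])
        - C (eulerSum [bar v, pl 1]) - C (eulerSum [bar u, bar 2])
        + C (eulerSum [pl 2] * eulerSum [bar u]) - C (eulerSum [bar w])) ∧
    (∑ p ∈ posPairs (w - 1), regStar [pl p.1, bar 1, pl p.2] =
      2 * C (eulerSum [pl u, bar 1, bar 1]) - 2 * C (eulerSum [pl u, bar 1, pl 1])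
        + C (eulerSum [bar 1, pl 1, pl u]) + regStar [pl 1, bar 1, pl u]
        - C (eulerSum [bar 1, bar 1, pl u]) + C (eulerSum [bar v, bar 1])
        + C (eulerSum [pl v, bar 1]) + C (eulerSum [bar 1, pl v]) - C (eulerSum [bar v, pl 1])
        - C (eulerSum [bar 1, bar v]) - C (eulerSum [pl 2, pl u])
        - 2 * C (eulerSum [pl u, bar 2]) - C (eulerSum [bar w]) - C (eulerSum [pl w])) ∧
    (∑ p ∈ posPairs (w - 1), eulerSum [bar p.1, bar 1, bar p.2] =
      3 * eulerSum [pl u, bar 1, pl 1] - 3 * eulerSum [pl u, bar 1, bar 1]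
        + eulerSum [bar 1, bar 1, pl u] + 2 * eulerSum [bar v, pl 1]
        - eulerSum [bar v, bar 1] + eulerSum [pl u, bar 2] + eulerSum [pl 2, pl u]
        - eulerSum [pl u, pl 2]) := by
  obtain rfl : w = u + 2 := by omega
  obtain rfl : v = u + 1 := by omega
  have hu2 : 2 ≤ u := by omega
  rw [show u + 2 - 1 = u + 1 by omega]
  have adm : ∀ (s : ℕ) (z : ℤˣ), 2 ≤ s → Admissible [(s, z)] := fun s z hs =>
    admissible_cons hs z (by simp)
  have adm1 : ∀ (s : ℕ) (z : ℤˣ), 1 ≤ s → Admissible [bar 1, (s, z)] := fun s z hs => by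
    simpa [Admissible] using hs
  have e1 : 1 + u = u + 1 := add_comm 1 u
  have e2 : 2 + u = u + 2 := add_comm 2 u
  have e3 : 1 + (u + 1) = u + 2 := by omega
  -- `ζ(2; y) ζ(u; z)`
  have p1 : ∀ y z : ℤˣ, eulerSum [(2, y)] * eulerSum [(u, z)] = eulerSum [(2, y), (u, z)] +
      eulerSum [(u, z), (2, y)] + eulerSum [(u + 2, y * z)] := fun y z => by
    simpa only [e2] using eulerSum_mul_depth_one (adm 2 y le_rfl) (adm u z hu2)
      (adm (2 + u) _ (by omega))
  -- `ζ(1̄) ζ(v; z)`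
  have p2 : ∀ z : ℤˣ, eulerSum [bar 1] * eulerSum [(u + 1, z)] = eulerSum [bar 1, (u + 1, z)] +
      eulerSum [(u + 1, z), bar 1] + eulerSum [(u + 2, -z)] := fun z => by
    simpa only [e3, neg_one_mul] using eulerSum_mul_depth_one admissible_bar_one
      (adm (u + 1) z (by omega)) (adm (1 + (u + 1)) _ (by omega))
  -- `ζ(1̄) ζ(u, 1; y, z)`
  have p3 : ∀ y z : ℤˣ, eulerSum [bar 1] * eulerSum [(u, y), (1, z)] =
      eulerSum [bar 1, (u, y), (1, z)] + eulerSum [(u, y), bar 1, (1, z)] +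
      eulerSum [(u, y), (1, z), bar 1] + eulerSum [(u + 1, -y), (1, z)] +
      eulerSum [(u, y), (2, -z)] := fun y z => by
    simpa only [e1, neg_one_mul] using eulerSum_mul_depth_two admissible_bar_one
      (admissible_cons hu2 y (l := [(1, z)]) (by simp)) (adm (1 + u) _ (by omega))
  -- `ζ(u; y) ζ(1̄, 1; z)`
  have p4 : ∀ y z : ℤˣ, eulerSum [(u, y)] * eulerSum [bar 1, (1, z)] =
      eulerSum [(u, y), bar 1, (1, z)] + eulerSum [bar 1, (u, y), (1, z)] +
      eulerSum [bar 1, (1, z), (u, y)] + eulerSum [(u + 1, -y), (1, z)] +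
      eulerSum [bar 1, (u + 1, y * z)] := fun y z => by
    simpa only [mul_neg_one] using eulerSum_mul_depth_two (adm u y hu2) (adm1 1 z le_rfl)
      (adm (u + 1) _ (by omega))
  have r1 := eulerSum_bar_one_one_add
  have r2 := eulerSum_bar_two
  have k1 := sum_regStar_pl 1 1 hu2
  have k2 := sum_regStar_pl (-1) (-1) hu2
  have k3 := sum_eulerSum_bar (-1) 1 hu2
  have k4 := sum_eulerSum_bar 1 (-1) hu2
  have k5 := sum_eulerSum_bar 1 1 hu2
  have k6 := sum_regStar_pl 1 (-1) hu2
  have k7 := sum_regStar_pl (-1) 1 hu2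
  have k8 := sum_eulerSum_bar (-1) (-1) hu2
  simp only [mul_neg, mul_one, neg_neg] at k1 k2 k3 k4 k5 k6 k7 k8
  have s1 := p1 1 1
  have s2 := p1 1 (-1)
  have s3 := p1 (-1) 1
  have s4 := p1 (-1) (-1)
  have t1 := p2 1
  have t2 := p2 (-1)
  have pp1 := p3 1 1
  have pp2 := p3 (-1) 1
  have pm1 := p3 1 (-1)
  have pm2 := p3 (-1) (-1)
  have qp1 := p4 1 1
  have qm1 := p4 1 (-1)
  have qm2 := p4 (-1) (-1)
  simp only [mul_neg, mul_one, neg_neg] at s1 s2 s3 s4 t1 t2 pp1 pp2 pm1 pm2 qp1 qm1 qm2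
  refine ⟨?_, ?_, ?_, ?_, ?_, ?_, ?_, ?_⟩
  · rw [k1, add_assoc (regStar _), ← C_add]
    congr 2
    linear_combination s1
  · rw [k2]
    simp only [add_assoc, add_sub_assoc, ← C_add, ← C_sub]
    congr 2
    linear_combination s4 + pm2 - pp2
  · rw [k3]
    linear_combination qm2 - pm2 + s2 - t1
  · rw [k4]
    linear_combination qp1 + s3 - t1 - pm1
  · rw [k5]
    linear_combination eulerSum [bar u] * r1 + qm2 - pm2 - t2
  -- No stuffle relation is needed here: the terms with factor `ζ(1̄)` cancel.
  · rw [k6]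
    have h : ∀ x : ℝ[X], 2 * x = x + x := fun x => by ring
    rw [h]
    simp only [C_add, C_sub, C_mul]
    ring
  · rw [k7]
    have h : ∀ x : ℝ[X], 2 * x = x + x := fun x => by ring
    rw [h, h, h]
    trans regStar [pl 1, bar 1, pl u] + C (2 * eulerSum [pl u, bar 1, bar 1] -
      2 * eulerSum [pl u, bar 1, pl 1] + eulerSum [bar 1, pl 1, pl u] -
      eulerSum [bar 1, bar 1, pl u] + eulerSum [bar (u + 1), bar 1] + eulerSum [pl (u + 1), bar 1] +
      eulerSum [bar 1, pl (u + 1)] - eulerSum [bar (u + 1), pl 1] - eulerSum [bar 1, bar (u + 1)] -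
      eulerSum [pl 2, pl u] - 2 * eulerSum [pl u, bar 2] - eulerSum [bar (u + 2)] -
      eulerSum [pl (u + 2)])
    · congr 2
      -- The weight-two relations give `ζ(2̄) = ζ(1̄,1) - ζ(1̄,1̄) - ζ(2)`, so that `ζ(2̄) ζ(u)` can
      -- be expanded through the other products.
      linear_combination pm1 - pp1 + qp1 - qm1 - s1 - eulerSum [pl u] * (r1 - r2)
    · simp only [two_mul, C_add, C_sub]
      ring
  · rw [k8]
    linear_combination qm1 + s1 - pm1 - t2
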